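/- **Setting.** Let $n\ge 1$, $m,k\ge 0$, let $\Omega\subset\mathbb R^n$ be a bounded open set with Lipschitz boundary, with outward unit normal $\mathbf n$ and surface measure $dS$ on $\partial\Omega$. Let $U\subset\mathbb R^n\times\mathbb R^m\times\mathbb R^{m\times n}$ be open and let $W,C^1,\dots,C^k:U\to\mathbb R$ be of class $C^1$ and scale-free: for $G=W$ and $G=C^i$, $G(\lambda x,\lambda y,F)=G(x,y,F)$ for all $\lambda>0$ whenever both points lie in $U$. For such $G$ put $$P_G=G_F,\qquad P^*_G=G\,I_n-F^{T}P_G ,$$ evaluated below at $(x,y(x),\nabla y(x))$. A configuration is *admissible* if $y\in C^1(\overline\Omega;\mathbb R^m)$, $(x,y(x),\nabla y(x))\in U$ for $x\in\overline\Omega$, and $C^i(x,y(x),\nabla y(x))=0$ for all $x\in\Omega$, $i=1,\dots,k$. Let $y$ be a constrained energy minimizer, i.e. $y$ is admissible and $\int_\Omega W(x,y,\nabla y)\,dx\le\int_\Omega W(x,z,\nabla z)\,dx$ for every admissible $z$ with $z=y$ on $\partial\Omega$. Let $\Lambda_1,\dots,\Lambda_k\in C(\overline\Omega)$ be Lagrange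 multipliers for $y$, i.e. $y$ is a stationary extremal of the augmented Lagrangian $L=W-\Lambda_iC^i$ (sum over $i$): in the sense of distributions on $\Omega$, $$ (W_y-\Lambda_iC^i_y)-\nabla\cdot(P_W-\Lambda_iP_{C^i})=0\quad\text{(Euler--Lagrange)},$$ $$ (W_x-\Lambda_iC^i_x)-\nabla\cdot(P^*_W-\Lambda_iP^*_{C^i})=0\quad\text{(stationarity)},$$ where the second equation need not be assumed if $y\in C^2(\Omega)$. **Theorem.** The following integrands are integrable and $$\int_\Omega nW(x,y,\nabla y)\,dx=\int_{\partial\Omega}\bigl\{(P_W-\Lambda_iP_{C^i})\mathbf n\cdot y+(P^*_W-\Lambda_iP^*_{C^i})\mathbf n\cdot x\bigr\}\,dS .$$ In particular, in the incompressible case $m=n$, $k=1$, $C^1=\det F-1$, $\Lambda_1=p$ (the pressure), with $P=P_W$, $P^*=P^*_W$, $F=\nabla y$ and $\operatorname{cof}F$ the cofactor matrix, $$\int_\Omega W(x,y,\nabla y)\,dx=\frac1n\int_{\partial\Omega}\bigl\{(P-p\,\operatorname{cof}F)\mathbf n\cdot y+(P^*+p\,I_n)\mathbf n\cdot x\bigr\}\,dS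 .$$ -/

import Mathlib

open MeasureTheory Topology
open scoped Matrix ContDiff

noncomputable section

/-- The Euclidean space `ℝⁿ`. -/
abbrev Vec (n : ℕ) : Type := EuclideanSpace ℝ (Fin n)

/-- The space of triples `(x, y, F)`, with `F` an `m × n` deformation gradient, seen as a linear
map `ℝⁿ → ℝᵐ`. Energy densities and constraints are real functions on (a part of) this space. -/
abbrev Jet (n m : ℕ) : Type := Vec n × Vec m × (Vec n →L[ℝ] Vec m)

/-- The matrix `F i α` of a linear map. -/
def gradMatrix {n m : ℕ} (F : Vec n →L[ℝ] Vec m) : Matrix (Fin m) (Fin n) ℝ :=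
  Matrix.of fun i α => F (EuclideanSpace.single α 1) i

/-- The linear map whose matrix has a single nonzero entry, equal to one, in position `(i, α)`. -/
def elemMap {n m : ℕ} (i : Fin m) (α : Fin n) : Vec n →L[ℝ] Vec m :=
  (EuclideanSpace.proj α : Vec n →L[ℝ] ℝ).smulRight (EuclideanSpace.single i 1)

/-- The Frobenius inner product `⟨A, B⟩ = ∑ A i α * B i α` of matrices. -/
def frob {n m : ℕ} (A B : Matrix (Fin m) (Fin n) ℝ) : ℝ :=
  ∑ i, ∑ α, A i α * B i α

/-- The Piola stress tensor `P = W_F`: the matrix of partial derivatives of `W` with respect to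
the entries of `F`. -/
def piola {n m : ℕ} (W : Jet n m → ℝ) (j : Jet n m) : Matrix (Fin m) (Fin n) ℝ :=
  Matrix.of fun i α => fderiv ℝ W j (0, 0, elemMap i α)

/-- The Eshelby tensor `P* = W I - Fᵀ P`. -/
def eshelby {n m : ℕ} (W : Jet n m → ℝ) (j : Jet n m) : Matrix (Fin n) (Fin n) ℝ :=
  W j • (1 : Matrix (Fin n) (Fin n) ℝ) - (gradMatrix j.2.2)ᵀ * piola W j

/-- The function `W` is scale-free on `U`: `W (λ x, λ y, F) = W (x, y, F)` for all `λ > 0`,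
whenever both points belong to `U`. -/
def IsScaleFree {n m : ℕ} (U : Set (Jet n m)) (W : Jet n m → ℝ) : Prop :=
  ∀ c : ℝ, 0 < c → ∀ (x : Vec n) (y : Vec m) (F : Vec n →L[ℝ] Vec m),
    (x, y, F) ∈ U → (c • x, c • y, F) ∈ U → W (c • x, c • y, F) = W (x, y, F)

/-- Bounded open sets with Lipschitz boundary: near each boundary point, `Ω` is the region below
the graph of a Lipschitz function, in the direction of some unit vector `e`. The function `g`
depends only on the component orthogonal to `e`. -/
def IsLipschitzDomain {n : ℕ} (Ω : Set (Vec n)) : Prop :=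
  IsOpen Ω ∧ Bornology.IsBounded Ω ∧
    ∀ p ∈ frontier Ω, ∃ (e : Vec n) (g : Vec n → ℝ) (K : NNReal) (V : Set (Vec n)),
      ‖e‖ = 1 ∧ LipschitzWith K g ∧ (∀ (z : Vec n) (t : ℝ), g (z + t • e) = g z) ∧
        V ∈ 𝓝 p ∧ ∀ x ∈ V, (x ∈ Ω ↔ inner ℝ e x < g x)

/-- The vector `ν` is the outward unit normal to `Ω` at `x`: near `x`, every open cone around
`-ν` smaller than a half-space lies in `Ω`, and every such cone around `ν` lies outside `Ω`. -/
def IsOuterNormal {n : ℕ} (Ω : Set (Vec n)) (x ν : Vec n) : Prop :=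
  ‖ν‖ = 1 ∧ ∀ ε > 0, ∃ δ > 0, ∀ z : Vec n, ‖z - x‖ < δ →
    (inner ℝ (z - x) ν < -ε * ‖z - x‖ → z ∈ Ω) ∧ (ε * ‖z - x‖ < inner ℝ (z - x) ν → z ∉ Ω)

open Classical in
/-- The outward unit normal field, where it exists (it is unique there), and zero elsewhere. -/
def outerNormal {n : ℕ} (Ω : Set (Vec n)) (x : Vec n) : Vec n :=
  if h : ∃ ν, IsOuterNormal Ω x ν then h.choose else 0

/-- The surface measure `dS` on `∂Ω`: the `(n - 1)`-dimensional Hausdorff measure, normalized to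
agree with Lebesgue measure on hyperplanes. -/
def surfaceMeasure {n : ℕ} (Ω : Set (Vec n)) : Measure (Vec n) :=
  (μHE[n - 1] : Measure (Vec n)).restrict (frontier Ω)

/-- The point `(x, y(x), ∇y(x))`, for `x` in the closure of `Ω`. -/
def jet {n m : ℕ} (Ω : Set (Vec n)) (y : Vec n → Vec m) (x : Vec n) : Jet n m :=
  (x, y x, fderivWithin ℝ y (closure Ω) x)

/-- The energy `∫_Ω W(x, y, ∇y) dx`. -/
def energy {n m : ℕ} (Ω : Set (Vec n)) (W : Jet n m → ℝ) (y : Vec n → Vec m) : ℝ :=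
  ∫ x in Ω, W (jet Ω y x)

/-- Configurations of class `C¹` up to the boundary, with `(x, y, ∇y)` in `U`, that satisfy the
pointwise constraints `Cⁱ(x, y, ∇y) = 0` in `Ω`. -/
def IsAdmissible {n m k : ℕ} (U : Set (Jet n m)) (C : Fin k → Jet n m → ℝ)
    (Ω : Set (Vec n)) (y : Vec n → Vec m) : Prop :=
  ContDiffOn ℝ 1 y (closure Ω) ∧ (∀ x ∈ closure Ω, jet Ω y x ∈ U) ∧
    ∀ x ∈ Ω, ∀ i, C i (jet Ω y x) = 0

/-- Constrained energy minimizers of class `C¹` (with respect to their own boundary values). -/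
def IsConstrainedMinimizer {n m k : ℕ} (U : Set (Jet n m)) (W : Jet n m → ℝ)
    (C : Fin k → Jet n m → ℝ) (Ω : Set (Vec n)) (y : Vec n → Vec m) : Prop :=
  IsAdmissible U C Ω y ∧ ∀ z : Vec n → Vec m, IsAdmissible U C Ω z →
    (∀ x ∈ frontier Ω, z x = y x) → energy Ω W y ≤ energy Ω W z

/-- Smooth test fields with compact support in `Ω`. -/
def IsTestField {n m : ℕ} (Ω : Set (Vec n)) (φ : Vec n → Vec m) : Prop :=
  ContDiff ℝ ∞ φ ∧ HasCompactSupport φ ∧ tsupport φ ⊆ Ω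

/-- The density `W_y · φ + ⟨P, ∇φ⟩` of the first variation of the energy when `δx = 0`,
`δy = φ`. -/
def outerVar {n m : ℕ} (Ω : Set (Vec n)) (W : Jet n m → ℝ) (y : Vec n → Vec m)
    (φ : Vec n → Vec m) (x : Vec n) : ℝ :=
  fderiv ℝ W (jet Ω y x) (0, φ x, 0) +
    frob (piola W (jet Ω y x)) (gradMatrix (fderiv ℝ φ x))

/-- The density `W_x · φ + ⟨P*, ∇φ⟩` of the first variation of the energy when `δx = φ`,
`δy = 0`. -/
def innerVar {n m : ℕ} (Ω : Set (Vec n)) (W : Jet n m → ℝ) (y : Vec n → Vec m)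
    (φ : Vec n → Vec n) (x : Vec n) : ℝ :=
  fderiv ℝ W (jet Ω y x) (φ x, 0, 0) +
    frob (eshelby W (jet Ω y x)) (gradMatrix (fderiv ℝ φ x))

/-- The Euler-Lagrange equations, in the sense of distributions, for the augmented Lagrangian
`L = W - Λᵢ Cⁱ`. -/
def SolvesEulerLagrange {n m k : ℕ} (W : Jet n m → ℝ) (C : Fin k → Jet n m → ℝ)
    (Ω : Set (Vec n)) (y : Vec n → Vec m) (Λ : Fin k → Vec n → ℝ) : Prop :=
  ∀ φ : Vec n → Vec m, IsTestField Ω φ →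
    ∫ x in Ω, (outerVar Ω W y φ x - ∑ i, Λ i x * outerVar Ω (C i) y φ x) = 0

/-- The stationarity (Noether) equations, in the sense of distributions, for the augmented
Lagrangian `L = W - Λᵢ Cⁱ`. -/
def SolvesStationarity {n m k : ℕ} (W : Jet n m → ℝ) (C : Fin k → Jet n m → ℝ)
    (Ω : Set (Vec n)) (y : Vec n → Vec m) (Λ : Fin k → Vec n → ℝ) : Prop :=
  ∀ φ : Vec n → Vec n, IsTestField Ω φ →
    ∫ x in Ω, (innerVar Ω W y φ x - ∑ i, Λ i x * innerVar Ω (C i) y φ x) = 0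

/-- The functions `Λᵢ` are Lagrange multipliers of the configuration `y`: they are continuous up
to the boundary and `y` is a stationary extremal of the augmented Lagrangian `W - Λᵢ Cⁱ`. When
`y` is of class `C²` in `Ω`, the Euler-Lagrange equations alone are required. -/
def IsLagrangeMultiplier {n m k : ℕ} (W : Jet n m → ℝ) (C : Fin k → Jet n m → ℝ)
    (Ω : Set (Vec n)) (y : Vec n → Vec m) (Λ : Fin k → Vec n → ℝ) : Prop :=
  (∀ i, ContinuousOn (Λ i) (closure Ω)) ∧ SolvesEulerLagrange W C Ω y Λ ∧
    (ContDiffOn ℝ 2 y Ω ∨ SolvesStationarity W C Ω y Λ)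

/-- The density of the boundary integral:
`(P_W - Λᵢ P_{Cⁱ}) n · y + (P*_W - Λᵢ P*_{Cⁱ}) n · x`. -/
def boundaryWork {n m k : ℕ} (W : Jet n m → ℝ) (C : Fin k → Jet n m → ℝ)
    (Ω : Set (Vec n)) (y : Vec n → Vec m) (Λ : Fin k → Vec n → ℝ) (x : Vec n) : ℝ :=
  ((piola W (jet Ω y x) - ∑ i, Λ i x • piola (C i) (jet Ω y x)) *ᵥ ⇑(outerNormal Ω x)) ⬝ᵥ ⇑(y x) +
  ((eshelby W (jet Ω y x) - ∑ i, Λ i x • eshelby (C i) (jet Ω y x)) *ᵥ ⇑(outerNormal Ω x)) ⬝ᵥ ⇑x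

/-- The incompressibility constraint `det F - 1 = 0`. -/
def incompressibility {n : ℕ} (_ : Fin 1) (j : Jet n n) : ℝ :=
  (gradMatrix j.2.2).det - 1

/-- The cofactor matrix. -/
def cof {n : ℕ} (A : Matrix (Fin n) (Fin n) ℝ) : Matrix (Fin n) (Fin n) ℝ :=
  A.adjugateᵀ

/-- The density of the boundary integral in the incompressible case:
`(P - p cof F) n · y + (P* + p I) n · x`. -/
def incompressibleWork {n : ℕ} (W : Jet n n → ℝ) (Ω : Set (Vec n)) (y : Vec n → Vec n)
    (p : Vec n → ℝ) (x : Vec n) : ℝ :=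
  ((piola W (jet Ω y x) - p x • cof (gradMatrix (jet Ω y x).2.2)) *ᵥ ⇑(outerNormal Ω x)) ⬝ᵥ ⇑(y x) +
  ((eshelby W (jet Ω y x) + p x • (1 : Matrix (Fin n) (Fin n) ℝ)) *ᵥ ⇑(outerNormal Ω x)) ⬝ᵥ ⇑x

end

/-! Scaling `(x, y) ↦ (λ x, λ y)` leaves `F = ∇y` unchanged, so a scale-free energy is multiplied by
`λⁿ`. Differentiating at `λ = 1` gives `n ∫ W`, and for a stationary extremal the same derivative is
a boundary term: this is Noether's theorem for the scaling symmetry.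

To make this rigorous, test the Euler–Lagrange equations with `θ y`, the stationarity equations with
`θ x`, and add. With `L = W - Λᵢ Cⁱ`, the terms carrying `θ` itself combine to the derivative of `L`
along `(x, y, 0)`, which vanishes by scale-freeness, plus `n L θ`, where `L = W` in `Ω` by the
constraints. The terms carrying `∇θ` form the field `B ↦ L_F : ((y - F x) ⊗ B) + L B(x)`, whose
distributional divergence is therefore `n W` (`hasWeakDivergence_scalingField`) and whose normal
component is the boundary integrand (`boundaryWork_eq_normalFlux`). If `y` is `C²`, stationarity
follows from Euler–Lagrange tested with `∇y ψ` (`SolvesEulerLagrange.solvesStationarity`).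

What remains is a divergence theorem on Lipschitz domains for fields that are only continuous up to
the boundary, with continuous weak divergence (`IsLipschitzDomain.gaussGreen`). A partition of unity
reduces it to a graph chart. There the test function is cut off by `η(depth / t)` and `t → 0`: the
gradient of the cutoff concentrates on the graph and produces the flux. Such cutoffs are only
Lipschitz, so weak identities are first extended to Lipschitz test functions by mollification. The
limit is an integral over the hyperplane, identified with the Hausdorff surface integral by an area
formula for Lipschitz graphs and the identity (area density) × (outer normal) = `e - ∇g`. -/

set_option linter.unusedSectionVars false

/-! ### Mollification: from smooth to Lipschitz test functions. -/

section Mollification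

open Set Filter Metric ContinuousLinearMap
open scoped Convolution NNReal

variable {E F : Type*} [NormedAddCommGroup E] [InnerProductSpace ℝ E] [FiniteDimensional ℝ E]
  [MeasurableSpace E] [BorelSpace E]
  [NormedAddCommGroup F] [NormedSpace ℝ F] [FiniteDimensional ℝ F]

theorem aestronglyMeasurable_continuousLinearMap_apply {X G : Type*} [MeasurableSpace X]
    [NormedAddCommGroup G] [NormedSpace ℝ G] {μ : Measure X} {A : X → G →L[ℝ] ℝ} {u : X → G}
    (hA : AEStronglyMeasurable A μ) (hu : AEStronglyMeasurable u μ) :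
    AEStronglyMeasurable (fun x => A x (u x)) μ :=
  isBoundedBilinearMap_apply.continuous.comp_aestronglyMeasurable (hA.prodMk hu)

/-- By Rademacher's theorem `ζ` is differentiable almost everywhere, and its Lipschitz constant
dominates the difference quotients, so one may differentiate under the integral. Having the
derivative as a mollification of `fderiv ℝ ζ` gives both the uniform bound and the a.e. convergence
used below. -/
theorem hasFDerivAt_normed_convolution_of_lipschitzWith {ζ : E → F} {K : ℝ≥0}
    (hζ : LipschitzWith K ζ) (φ : ContDiffBump (0 : E)) (x : E) :
    HasFDerivAt (φ.normed volume ⋆[lsmul ℝ ℝ, volume] ζ : E → F)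
      ((φ.normed volume ⋆[lsmul ℝ ℝ, volume] fderiv ℝ ζ : E → E →L[ℝ] F) x) x := by
  have hφ : Integrable (φ.normed (volume : Measure E)) := φ.integrable_normed
  have hmeas : ∀ z : E, AEStronglyMeasurable
      (fun t => φ.normed volume t • ζ (z - t)) volume := fun z =>
    (φ.continuous_normed.smul (hζ.continuous.comp (by fun_prop))).aestronglyMeasurable
  have hcs : ∀ z : E, Integrable (fun t => φ.normed volume t • ζ (z - t)) volume := fun z =>
    (φ.continuous_normed.smul (hζ.continuous.comp (by fun_prop))).integrable_of_hasCompactSupport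
      φ.hasCompactSupport_normed.smul_right
  refine (hasFDerivAt_integral_of_dominated_loc_of_lip (s := univ)
    (F := fun z t => φ.normed volume t • ζ (z - t))
    (F' := fun t => φ.normed volume t • fderiv ℝ ζ (x - t))
    (bound := fun t => φ.normed volume t * K) univ_mem
    (Eventually.of_forall hmeas) (hcs x) ?_ ?_ (hφ.mul_const _) ?_).2
  · refine φ.continuous_normed.aestronglyMeasurable.smul ?_
    exact ((measurable_fderiv ℝ ζ).comp (measurable_const.sub measurable_id)).aestronglyMeasurable
  · refine Eventually.of_forall fun t => LipschitzOnWith.of_dist_le_mul fun a _ b _ => ?_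
    simp only [Real.coe_nnabs, dist_eq_norm, ← smul_sub, norm_smul, Real.norm_eq_abs, abs_mul,
      NNReal.abs_eq, mul_assoc]
    gcongr
    simpa using hζ.norm_sub_le (a - t) (b - t)
  · have h := (Measure.measurePreserving_sub_left (volume : Measure E) x).quasiMeasurePreserving.ae
      hζ.ae_differentiableAt
    filter_upwards [h] with t ht
    have := ht.hasFDerivAt.comp x ((hasFDerivAt_id x).sub_const t)
    exact this.const_smul _

theorem norm_normed_convolution_sub_le_of_lipschitzWith {ζ : E → F} {K : ℝ≥0}
    (hζ : LipschitzWith K ζ) (φ : ContDiffBump (0 : E)) (x : E) :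
    ‖(φ.normed volume ⋆[lsmul ℝ ℝ, volume] ζ : E → F) x - ζ x‖ ≤ K * φ.rOut := by
  rw [← dist_eq_norm]
  refine φ.dist_normed_convolution_le hζ.continuous.aestronglyMeasurable fun z hz => ?_
  exact (hζ.dist_le_mul _ _).trans (by gcongr; exact (mem_ball.1 hz).le)

theorem norm_normed_convolution_fderiv_le_of_lipschitzWith {ζ : E → F} {K : ℝ≥0}
    (hζ : LipschitzWith K ζ) (φ : ContDiffBump (0 : E)) (x : E) :
    ‖(φ.normed volume ⋆[lsmul ℝ ℝ, volume] fderiv ℝ ζ : E → E →L[ℝ] F) x‖ ≤ K := by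
  rw [← dist_zero_right]
  refine dist_convolution_le (z₀ := 0) K.2 φ.support_normed_eq.subset φ.nonneg_normed
    φ.integral_normed (measurable_fderiv ℝ ζ).aestronglyMeasurable fun z _ => ?_
  simpa using norm_fderiv_le_of_lipschitz ℝ hζ

/-- A first order distributional identity with continuous coefficients that holds for smooth test
functions holds for Lipschitz ones. -/
theorem setIntegral_eq_zero_of_lipschitz_of_smooth {Ω : Set E} (hΩ : IsOpen Ω)
    {A : E → (E →L[ℝ] F) →L[ℝ] ℝ} {b : E → F →L[ℝ] ℝ}
    (hA : ContinuousOn A Ω) (hb : ContinuousOn b Ω)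
    (h : ∀ φ : E → F, ContDiff ℝ ∞ φ → HasCompactSupport φ → tsupport φ ⊆ Ω →
      ∫ x in Ω, (A x (fderiv ℝ φ x) + b x (φ x)) = 0)
    {ζ : E → F} {K : ℝ≥0} (hζ : LipschitzWith K ζ) (hc : HasCompactSupport ζ)
    (hs : tsupport ζ ⊆ Ω) :
    ∫ x in Ω, (A x (fderiv ℝ ζ x) + b x (ζ x)) = 0 := by
  obtain ⟨r, hr, hrΩ⟩ := hc.isCompact.exists_cthickening_subset_open hΩ hs
  set S := cthickening r (tsupport ζ) with hS
  have hSc : IsCompact S := hc.isCompact.cthickening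
  -- Outer radii at most `r` keep the mollified supports in the compact set `S ⊆ Ω`; the fixed ratio
  -- 2 between outer and inner radius is what a.e. convergence of the mollified gradients requires.
  let φ : ℕ → ContDiffBump (0 : E) := fun k =>
    ⟨r / (k + 2) / 2, r / (k + 2), by positivity, half_lt_self (by positivity)⟩
  have hφr : ∀ k, (φ k).rOut ≤ r := fun k =>
    div_le_self hr.le (by linarith [(Nat.cast_nonneg k : (0 : ℝ) ≤ k)])
  have hφ0 : Tendsto (fun k => (φ k).rOut) atTop (𝓝 0) := by
    refine tendsto_const_nhds.div_atTop ?_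
    exact tendsto_atTop_add_const_right _ _ tendsto_natCast_atTop_atTop
  let ψ : ℕ → E → F := fun k => (φ k).normed volume ⋆[lsmul ℝ ℝ, volume] ζ
  have hd : ∀ k x, HasFDerivAt (ψ k)
      (((φ k).normed volume ⋆[lsmul ℝ ℝ, volume] fderiv ℝ ζ : E → E →L[ℝ] F) x) x := fun k x =>
    hasFDerivAt_normed_convolution_of_lipschitzWith hζ (φ k) x
  have hsupp : ∀ k, tsupport (ψ k) ⊆ S := by
    intro k
    refine closure_minimal ?_ isClosed_cthickening
    refine (support_convolution_subset _).trans ?_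
    rw [ContDiffBump.support_normed_eq]
    rintro _ ⟨a, ha, z, hz, rfl⟩
    refine mem_cthickening_of_dist_le _ z r _ (subset_tsupport _ hz) ?_
    simpa using (mem_ball_zero_iff.1 ha).le.trans (hφr k)
  have hψ : ∀ k, ∫ x in Ω, (A x (fderiv ℝ (ψ k) x) + b x (ψ k x)) = 0 := by
    intro k
    refine h _ ?_ ?_ ((hsupp k).trans hrΩ)
    · exact (φ k).hasCompactSupport_normed.contDiff_convolution_left _ (φ k).contDiff_normed
        hζ.continuous.locallyIntegrable
    · exact hSc.of_isClosed_subset (isClosed_tsupport _) (hsupp k)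
  obtain ⟨M, hM⟩ : ∃ M, ∀ x, ‖ζ x‖ ≤ M := hc.exists_bound_of_continuous hζ.continuous
  have hM0 : 0 ≤ M := (norm_nonneg _).trans (hM 0)
  have hAS : ContinuousOn A S := hA.mono hrΩ
  have hbS : ContinuousOn b S := hb.mono hrΩ
  obtain ⟨a, ha⟩ := hSc.exists_bound_of_continuousOn (f := A) hAS
  obtain ⟨c, hc'⟩ := hSc.exists_bound_of_continuousOn (f := b) hbS
  have hΩm := hΩ.measurableSet
  have hlim : Tendsto (fun k => ∫ x in Ω, (A x (fderiv ℝ (ψ k) x) + b x (ψ k x))) atTop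
      (𝓝 (∫ x in Ω, (A x (fderiv ℝ ζ x) + b x (ζ x)))) := by
    refine tendsto_integral_of_dominated_convergence
      (S.indicator fun _ => a * K + c * (M + K * r)) ?_ ?_ ?_ ?_
    · intro k
      have h1 : AEStronglyMeasurable A (volume.restrict Ω) := hA.aestronglyMeasurable hΩm
      have h2 : AEStronglyMeasurable b (volume.restrict Ω) := hb.aestronglyMeasurable hΩm
      have h3 : Continuous (ψ k) := continuous_iff_continuousAt.2 fun x => (hd k x).continuousAt
      exact (aestronglyMeasurable_continuousLinearMap_apply h1
        (measurable_fderiv ℝ (ψ k)).aestronglyMeasurable).add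
        (aestronglyMeasurable_continuousLinearMap_apply h2 h3.aestronglyMeasurable)
    · refine (integrable_indicator_iff hSc.measurableSet).2 ?_
      exact (integrableOn_const hSc.measure_ne_top).mono_measure Measure.restrict_le_self
    · intro k
      refine Eventually.of_forall fun x => ?_
      by_cases hx : x ∈ S
      · rw [indicator_of_mem hx, (hd k x).fderiv]
        have h1 := norm_normed_convolution_fderiv_le_of_lipschitzWith hζ (φ k) x
        have h2 : ‖ψ k x‖ ≤ M + K * r := by
          have h3 := norm_normed_convolution_sub_le_of_lipschitzWith hζ (φ k) x
          have h4 : ‖ψ k x‖ ≤ ‖ζ x‖ + ‖ψ k x - ζ x‖ := by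
            simpa using norm_add_le (ζ x) (ψ k x - ζ x)
          have h5 : (K : ℝ) * (φ k).rOut ≤ K * r := by gcongr; exact hφr k
          linarith [hM x]
        refine (norm_add_le _ _).trans (add_le_add ?_ ?_)
        · refine (le_opNorm _ _).trans ?_
          exact mul_le_mul (ha x hx) h1 (norm_nonneg _) ((norm_nonneg _).trans (ha x hx))
        · refine (le_opNorm _ _).trans ?_
          exact mul_le_mul (hc' x hx) h2 (norm_nonneg _) ((norm_nonneg _).trans (hc' x hx))
      · have h0 : x ∉ tsupport (ψ k) := fun hx' => hx (hsupp k hx')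
        have h1 : fderiv ℝ (ψ k) x = 0 := fderiv_of_notMem_tsupport ℝ h0
        rw [indicator_of_notMem hx, h1, image_eq_zero_of_notMem_tsupport h0]
        simp
    · have hli : LocallyIntegrable (fderiv ℝ ζ) (volume : Measure E) := by
        refine (locallyIntegrable_const (K : ℝ)).mono
          (measurable_fderiv ℝ ζ).aestronglyMeasurable (Eventually.of_forall fun x => ?_)
        simpa using norm_fderiv_le_of_lipschitz ℝ hζ
      have hae := ContDiffBump.ae_convolution_tendsto_right_of_locallyIntegrable
        (φ := φ) (K := 2) hφ0
        (Eventually.of_forall fun k => by simp only [φ]; linarith) hli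
      filter_upwards [ae_restrict_of_ae hae] with x hx
      have h1 : Tendsto (fun k => fderiv ℝ (ψ k) x) atTop (𝓝 (fderiv ℝ ζ x)) :=
        hx.congr fun k => (hd k x).fderiv.symm
      have h2 : Tendsto (fun k => ψ k x) atTop (𝓝 (ζ x)) :=
        ContDiffBump.convolution_tendsto_right_of_continuous hφ0 hζ.continuous x
      exact (((A x).continuous.tendsto _).comp h1).add (((b x).continuous.tendsto _).comp h2)
  exact tendsto_nhds_unique hlim (by simp only [hψ]; exact tendsto_const_nhds)

end Mollification

/-! ### The area formula for non-contracting Lipschitz maps. -/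

section AreaFormula

open Set Filter Metric Module
open scoped NNReal ENNReal

/-- On `s` the map `f` factors through `g` by a `C`-Lipschitz map. Comparing two maps, instead of a
map with its domain, allows a nonlinear map and its linear approximation to be compared in both
directions. -/
theorem euclideanHausdorffMeasure_image_le_of_dist_le {X Y Z : Type*} [Nonempty X]
    [MetricSpace Y] [MeasurableSpace Y] [BorelSpace Y]
    [MetricSpace Z] [MeasurableSpace Z] [BorelSpace Z] {f : X → Y} {g : X → Z} {s : Set X}
    {C : ℝ≥0} (h : ∀ x ∈ s, ∀ y ∈ s, dist (f x) (f y) ≤ C * dist (g x) (g y)) (d : ℕ) :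
    μHE[d] (f '' s) ≤ (C : ℝ≥0∞) ^ d * μHE[d] (g '' s) := by
  let k : Z → Y := f ∘ Function.invFunOn g s
  have hmem : ∀ x ∈ s, Function.invFunOn g s (g x) ∈ s := fun x hx =>
    Function.invFunOn_mem ⟨x, hx, rfl⟩
  have heq : ∀ x ∈ s, g (Function.invFunOn g s (g x)) = g x := fun x hx =>
    Function.invFunOn_eq ⟨x, hx, rfl⟩
  have hk : LipschitzOnWith C k (g '' s) := by
    refine LipschitzOnWith.of_dist_le_mul ?_
    rintro _ ⟨x, hx, rfl⟩ _ ⟨y, hy, rfl⟩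
    have := h _ (hmem x hx) _ (hmem y hy)
    rwa [heq x hx, heq y hy] at this
  have hsub : f '' s ⊆ k '' (g '' s) := by
    rintro _ ⟨x, hx, rfl⟩
    refine ⟨g x, ⟨x, hx, rfl⟩, ?_⟩
    have := h _ (hmem x hx) _ hx
    rw [heq x hx, dist_self, mul_zero] at this
    exact dist_le_zero.1 this
  have h1 := hk.hausdorffMeasure_image_le (d := (d : ℝ)) (by positivity)
  simp only [Measure.euclideanHausdorffMeasure_def, Measure.smul_apply]
  calc _ ≤ _ • (μH[(d : ℝ)] (k '' (g '' s))) := by gcongr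
    _ ≤ _ • ((C : ℝ≥0∞) ^ (d : ℝ) * μH[(d : ℝ)] (g '' s)) := by gcongr
    _ = _ := by rw [ENNReal.rpow_natCast, ENNReal.smul_def, ENNReal.smul_def, smul_eq_mul,
                  smul_eq_mul, mul_left_comm]

theorem measure_le_of_iUnion_eq_univ {X ι : Type*} [MeasurableSpace X] [Countable ι]
    {μ ν : Measure X} {t : ι → Set X} (ht : ∀ i, MeasurableSet (t i)) (hU : ⋃ i, t i = univ)
    (h : ∀ i s, MeasurableSet s → s ⊆ t i → μ s ≤ ν s) : μ ≤ ν := by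
  rcases isEmpty_or_nonempty ι with hι | hι
  · have : (univ : Set X) = ∅ := by rw [← hU, iUnion_of_empty]
    have : IsEmpty X := univ_eq_empty_iff.1 this
    exact Measure.le_iff.2 fun s _ => by simp [Subsingleton.elim s ∅]
  obtain ⟨e, he⟩ := exists_surjective_nat ι
  refine Measure.le_iff.2 fun s hs => ?_
  have hUe : ⋃ n, disjointed (fun n => t (e n)) n = univ := by
    rw [iUnion_disjointed, he.iUnion_comp (g := t), hU]
  have hm : ∀ n, MeasurableSet (s ∩ disjointed (fun n => t (e n)) n) := fun n =>
    hs.inter (MeasurableSet.disjointed (fun n => ht (e n)) n)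
  have hd : Pairwise (Function.onFun Disjoint fun n => s ∩ disjointed (fun n => t (e n)) n) :=
    fun i j hij => (disjoint_disjointed _ hij).mono inter_subset_right inter_subset_right
  have hs' : s = ⋃ n, s ∩ disjointed (fun n => t (e n)) n := by
    rw [← inter_iUnion, hUe, inter_univ]
  rw [hs', measure_iUnion hd hm, measure_iUnion hd hm]
  exact ENNReal.tsum_le_tsum fun n =>
    h (e n) _ (hm n) (inter_subset_right.trans (disjointed_subset _ n))

variable {H E : Type*} [NormedAddCommGroup H] [InnerProductSpace ℝ H] [FiniteDimensional ℝ H]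
  [MeasurableSpace H] [BorelSpace H] [NormedAddCommGroup E] [InnerProductSpace ℝ E]
  [FiniteDimensional ℝ E] [MeasurableSpace E] [BorelSpace E]

theorem continuous_normDet : Continuous fun A : H →L[ℝ] E => (A : H →ₗ[ℝ] E).normDet := by
  have h : (fun A : H →L[ℝ] E => (A : H →ₗ[ℝ] E).normDet) =
      fun A : H →L[ℝ] E => Real.sqrt ((A.adjoint ∘L A).det) := by
    funext A
    have := A.normDet_sq
    simp only [RCLike.ofReal_real_eq_id, id] at this
    rw [← this, Real.sqrt_sq (LinearMap.normDet_nonneg _)]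
  rw [h]
  refine Real.continuous_sqrt.comp (ContinuousLinearMap.continuous_det.comp ?_)
  exact (ContinuousLinearMap.adjoint.continuous).clm_comp continuous_id

/-- Compare the measures of the two images of the unit ball, then cancel the volume of the ball. -/
theorem normDet_le_of_norm_le {A B : H →ₗ[ℝ] E} {C : ℝ≥0} (h : ∀ v, ‖A v‖ ≤ C * ‖B v‖) :
    ENNReal.ofReal A.normDet ≤ (C : ℝ≥0∞) ^ finrank ℝ H * ENNReal.ofReal B.normDet := by
  have h1 := euclideanHausdorffMeasure_image_le_of_dist_le (f := A) (g := B) (s := ball (0 : H) 1)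
    (C := C) (fun x _ y _ => by simpa [dist_eq_norm] using h (x - y)) (finrank ℝ H)
  rw [A.euclideanHausdorffMeasure_image_eq_normDet_mul_volume,
    B.euclideanHausdorffMeasure_image_eq_normDet_mul_volume, ← mul_assoc] at h1
  exact (ENNReal.mul_le_mul_iff_left (measure_ball_pos _ _ one_pos).ne'
    measure_ball_lt_top.ne).1 h1

/-- The area formula for bi-Lipschitz maps that do not decrease distances. -/
theorem euclideanHausdorffMeasure_image_eq_lintegral_normDet {f : H → E} {K : ℝ≥0}
    (hf : LipschitzWith K f) (hf' : ∀ x y, dist x y ≤ dist (f x) (f y)) {s : Set H}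
    (hs : MeasurableSet s) :
    μHE[finrank ℝ H] (f '' s) =
      ∫⁻ x in s, ENNReal.ofReal (fderiv ℝ f x : H →ₗ[ℝ] E).normDet := by
  set d := finrank ℝ H with hd
  have hanti : AntilipschitzWith 1 f := AntilipschitzWith.of_le_mul_dist fun x y => by
    simpa using hf' x y
  have hemb : MeasurableEmbedding f :=
    (hanti.isClosedEmbedding hf.uniformContinuous).measurableEmbedding
  set ν : Measure H := Measure.comap f μHE[d]
  have hν : ∀ t, MeasurableSet t → ν t = μHE[d] (f '' t) := fun t _ =>
    hemb.comap_apply _ _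
  set J : H → ℝ≥0∞ := fun x => ENNReal.ofReal (fderiv ℝ f x : H →ₗ[ℝ] E).normDet with hJ
  have hJm : Measurable J :=
    (continuous_normDet.measurable.comp (measurable_fderiv ℝ f)).ennreal_ofReal
  set ρ : Measure H := volume.withDensity J
  suffices hνρ : ν = ρ by
    rw [← hν s hs, hνρ, withDensity_apply _ hs]
  set S : Set H := {x | DifferentiableAt ℝ f x} with hS
  have hSm : MeasurableSet S := measurableSet_of_differentiableAt ℝ f
  have hS0 : volume Sᶜ = 0 := hf.ae_differentiableAt
  have hSν : ν Sᶜ = 0 := by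
    rw [hν _ hSm.compl]
    have h1 := euclideanHausdorffMeasure_image_le_of_dist_le (f := f) (g := id) (s := Sᶜ)
      (fun x _ y _ => hf.dist_le_mul x y) d
    rw [image_id, hd, InnerProductSpace.euclideanHausdorffMeasure_eq_volume, hS0, mul_zero] at h1
    exact le_antisymm h1 bot_le
  -- The derivative inherits non-contraction as a limit of difference quotients.
  have hlow : ∀ x ∈ S, ∀ v, ‖v‖ ≤ ‖fderiv ℝ f x v‖ := by
    intro x hx v
    have h1 := hx.hasFDerivAt.hasLineDerivAt v
    have h2 := h1.tendsto_slope_zero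
    refine ge_of_tendsto h2.norm ?_
    filter_upwards [self_mem_nhdsWithin] with t ht
    have h3 := hf' (x + t • v) x
    rw [dist_eq_norm, dist_eq_norm, add_sub_cancel_left, norm_smul] at h3
    rw [norm_smul, norm_inv, ← div_eq_inv_mul, le_div_iff₀ (norm_pos_iff.2 ht), mul_comm]
    exact h3
  -- Up to a factor tending to 1, both measures agree with `normDet L * volume` on countably many
  -- pieces where `f` is nearly a linear map `L`.
  have key : ∀ δ : ℝ≥0, 0 < δ →
      ν ≤ ((1 + δ : ℝ≥0) ^ (2 * d) : ℝ≥0∞) • ρ ∧ ρ ≤ ((1 + δ : ℝ≥0) ^ (2 * d) : ℝ≥0∞) • ν := by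
    intro δ hδ
    have hδ2 : (0 : ℝ≥0) < δ / 2 := half_pos hδ
    -- Grouping points by a nearby member of a countable dense family of linear maps makes the
    -- derivative nearly constant on each piece, in addition to `f` being nearly linear there.
    let B : ℕ → H →L[ℝ] E := TopologicalSpace.denseSeq (H →L[ℝ] E)
    let T : ℕ → Set H := fun k => {x | x ∈ S ∧ ‖fderiv ℝ f x - B k‖ ≤ (δ / 2 : ℝ≥0)}
    have hTm : ∀ k, MeasurableSet (T k) := fun k => hSm.inter <|
      measurableSet_le ((measurable_fderiv ℝ f).sub_const _).norm measurable_const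
    have hpart := fun k => exists_partition_approximatesLinearOn_of_hasFDerivWithinAt f (T k)
      (fderiv ℝ f) (fun x hx => hx.1.hasFDerivAt.hasFDerivWithinAt) (fun _ => δ)
      (fun _ => hδ.ne')
    choose t A _ htm htc happ hA using hpart
    let P : Option (ℕ × ℕ) → Set H := fun i => i.elim Sᶜ fun p => T p.1 ∩ t p.1 p.2
    have hPm : ∀ i, MeasurableSet (P i) := by
      rintro (_ | p)
      · exact hSm.compl
      · exact (hTm _).inter (htm _ _)
    have hPU : ⋃ i, P i = univ := by
      refine eq_univ_of_forall fun x => ?_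
      by_cases hx : x ∈ S
      · obtain ⟨k, hk⟩ := (TopologicalSpace.denseRange_denseSeq (H →L[ℝ] E)).exists_dist_lt
          (fderiv ℝ f x) (NNReal.coe_pos.2 hδ2)
        have hxT : x ∈ T k := ⟨hx, by rw [← dist_eq_norm]; exact hk.le⟩
        obtain ⟨n, hn⟩ := mem_iUnion.1 (htc k hxT)
        exact mem_iUnion.2 ⟨some (k, n), hxT, hn⟩
      · exact mem_iUnion.2 ⟨none, hx⟩
    have hmain : ∀ i u, MeasurableSet u → u ⊆ P i →
        ν u ≤ ((1 + δ : ℝ≥0) ^ (2 * d) : ℝ≥0∞) * ρ u ∧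
        ρ u ≤ ((1 + δ : ℝ≥0) ^ (2 * d) : ℝ≥0∞) * ν u := by
      rintro (_ | ⟨k, n⟩) u hu huP
      · have h1 : ν u = 0 := measure_mono_null huP hSν
        have h2 : ρ u = 0 := withDensity_absolutelyContinuous _ _ (measure_mono_null huP hS0)
        simp [h1, h2]
      · rcases u.eq_empty_or_nonempty with rfl | ⟨x₀, hx₀⟩
        · simp
        have huT : u ⊆ T k ∩ t k n := huP
        -- The approximating map is the derivative at a point of the same group, so it is
        -- non-contracting and `δ`-close to every derivative on `u`.
        obtain ⟨y, hyT, hAy⟩ := hA k ⟨x₀, (huT hx₀).1⟩ n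
        set L : H →L[ℝ] E := A k n with hL
        have hLlow : ∀ v, ‖v‖ ≤ ‖L v‖ := by rw [hAy]; exact hlow y hyT.1
        have hclose : ∀ x ∈ u, ‖fderiv ℝ f x - L‖ ≤ δ := by
          intro x hx
          have h1 := (huT hx).1.2
          have h2 := hyT.2
          have h3 : fderiv ℝ f x - L = (fderiv ℝ f x - B k) - (fderiv ℝ f y - B k) := by
            rw [hAy]; abel
          rw [h3]
          refine (norm_sub_le _ _).trans ((add_le_add h1 h2).trans_eq ?_)
          push_cast; ring
        -- Since none of the maps contracts, an additive error `δ‖v‖` is absorbed into a factor `1 +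
        -- δ`.
        have hmul : ∀ (a b c : ℝ), a ≤ b + δ * c → c ≤ b → a ≤ ((1 + δ : ℝ≥0) : ℝ) * b := by
          intro a b c h1 h2
          have h3 : (δ : ℝ) * c ≤ δ * b := by gcongr
          push_cast
          linarith
        have happx : ∀ x ∈ u, ∀ z ∈ u, ‖f x - f z - L (x - z)‖ ≤ δ * ‖x - z‖ :=
          fun x hx z hz => happ k n x (huT hx) z (huT hz)
        have m1 : ν u ≤ ((1 + δ : ℝ≥0) : ℝ≥0∞) ^ d * (ENNReal.ofReal (L : H →ₗ[ℝ] E).normDet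
            * volume u) := by
          rw [hν u hu, hd, ← (L : H →ₗ[ℝ] E).euclideanHausdorffMeasure_image_eq_normDet_mul_volume]
          refine euclideanHausdorffMeasure_image_le_of_dist_le (fun x hx z hz => ?_) _
          simp only [dist_eq_norm, ContinuousLinearMap.coe_coe, ← map_sub]
          refine hmul _ _ ‖x - z‖ ?_ (hLlow _)
          have := norm_add_le (L (x - z)) (f x - f z - L (x - z))
          rw [add_sub_cancel] at this
          linarith [happx x hx z hz]
        have m2 : ENNReal.ofReal (L : H →ₗ[ℝ] E).normDet * volume u ≤
            ((1 + δ : ℝ≥0) : ℝ≥0∞) ^ d * ν u := by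
          rw [hν u hu, hd, ← (L : H →ₗ[ℝ] E).euclideanHausdorffMeasure_image_eq_normDet_mul_volume]
          refine euclideanHausdorffMeasure_image_le_of_dist_le (fun x hx z hz => ?_) _
          simp only [dist_eq_norm, ContinuousLinearMap.coe_coe, ← map_sub]
          refine hmul _ _ ‖x - z‖ ?_ (by simpa [dist_eq_norm] using hf' x z)
          have := norm_sub_le (f x - f z) (f x - f z - L (x - z))
          rw [sub_sub_cancel] at this
          linarith [happx x hx z hz]
        have hρ : ρ u = ∫⁻ x in u, J x := withDensity_apply _ hu
        have m3 : ENNReal.ofReal (L : H →ₗ[ℝ] E).normDet * volume u ≤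
            ((1 + δ : ℝ≥0) : ℝ≥0∞) ^ d * ρ u := by
          rw [hρ, ← lintegral_const_mul _ hJm, ← setLIntegral_const]
          refine setLIntegral_mono' hu fun x hx => normDet_le_of_norm_le fun v => ?_
          refine hmul _ _ ‖v‖ ?_ (hlow x (huT hx).1.1 v)
          have h1 := norm_sub_le (fderiv ℝ f x v) ((fderiv ℝ f x - L) v)
          have h2 := ((fderiv ℝ f x - L).le_opNorm v).trans
            (mul_le_mul_of_nonneg_right (hclose x hx) (norm_nonneg v))
          simp only [_root_.sub_apply, sub_sub_cancel] at h1
          simp only [_root_.sub_apply] at h2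
          simp only [ContinuousLinearMap.coe_coe]
          linarith
        have m4 : ρ u ≤ ((1 + δ : ℝ≥0) : ℝ≥0∞) ^ d *
            (ENNReal.ofReal (L : H →ₗ[ℝ] E).normDet * volume u) := by
          rw [hρ, ← mul_assoc, ← setLIntegral_const]
          refine setLIntegral_mono' hu fun x hx => normDet_le_of_norm_le fun v => ?_
          refine hmul _ _ ‖v‖ ?_ (hLlow v)
          have h1 := norm_add_le (L v) ((fderiv ℝ f x - L) v)
          have h2 := ((fderiv ℝ f x - L).le_opNorm v).trans
            (mul_le_mul_of_nonneg_right (hclose x hx) (norm_nonneg v))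
          simp only [_root_.sub_apply, add_sub_cancel] at h1
          simp only [_root_.sub_apply] at h2
          simp only [ContinuousLinearMap.coe_coe]
          linarith
        -- The exponent `2 * d` pays twice: once to pass from `f` to `L`, once from `L` to the
        -- derivative of `f`.
        rw [two_mul, pow_add, mul_assoc, mul_assoc]
        exact ⟨m1.trans (by gcongr), m4.trans (by gcongr)⟩
    exact ⟨measure_le_of_iUnion_eq_univ hPm hPU fun i u hu hi => (hmain i u hu hi).1,
      measure_le_of_iUnion_eq_univ hPm hPU fun i u hu hi => (hmain i u hu hi).2⟩
  have hlim : ∀ a : ℝ≥0∞, Tendsto (fun n : ℕ =>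
      ((1 + (1 / ((n : ℝ≥0) + 1)) : ℝ≥0) : ℝ≥0∞) ^ (2 * d) * a) atTop (𝓝 a) := by
    intro a
    have h1 : Tendsto (fun n : ℕ => (1 + (1 / ((n : ℝ≥0) + 1)) : ℝ≥0)) atTop (𝓝 (1 + 0)) :=
      tendsto_const_nhds.add tendsto_one_div_add_atTop_nhds_zero_nat
    rw [add_zero] at h1
    have h2 := ENNReal.Tendsto.pow (n := 2 * d) (ENNReal.tendsto_coe.2 h1)
    simpa using ENNReal.Tendsto.mul_const (b := a) h2 (by simp)
  refine le_antisymm ?_ ?_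
  · exact Measure.le_iff.2 fun u _ => ge_of_tendsto' (hlim (ρ u)) fun n =>
      (key _ (by positivity)).1 u
  · exact Measure.le_iff.2 fun u _ => ge_of_tendsto' (hlim (ν u)) fun n =>
      (key _ (by positivity)).2 u

end AreaFormula

/-! ### Lipschitz graphs over a hyperplane: surface measure and volume in graph coordinates. -/

section GraphMap

open Set Filter Metric Module
open scoped NNReal ENNReal RealInnerProductSpace

variable {E : Type*} [NormedAddCommGroup E] [InnerProductSpace ℝ E] [FiniteDimensional ℝ E]

/-- The orthogonal projection onto the hyperplane orthogonal to `e`. -/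
noncomputable def hyperProj (e : E) : E →L[ℝ] (ℝ ∙ e)ᗮ :=
  (ℝ ∙ e)ᗮ.orthogonalProjectionOnto

/-- The point of the graph of `g`, in the direction `e`, over a point of the hyperplane. -/
def graphMap {e : E} (g : (ℝ ∙ e)ᗮ → ℝ) (u : (ℝ ∙ e)ᗮ) : E := u + g u • e

/-- The distance, in the direction `e`, from a point to the graph of `g` above it. -/
noncomputable def graphDepth {e : E} (g : (ℝ ∙ e)ᗮ → ℝ) (x : E) : ℝ :=
  g (hyperProj e x) - ⟪e, x⟫

theorem coe_hyperProj {e : E} (he : ‖e‖ = 1) (x : E) : (hyperProj e x : E) = x - ⟪e, x⟫ • e := by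
  have h := Submodule.starProjection_orthogonal_val (K := ℝ ∙ e) x
  rw [Submodule.starProjection_unit_singleton ℝ he] at h
  exact h

theorem inner_coe_hyperplane {e : E} (u : (ℝ ∙ e)ᗮ) : ⟪e, (u : E)⟫ = 0 :=
  Submodule.mem_orthogonal_singleton_iff_inner_right.1 u.2

theorem hyperProj_coe_add_smul {e : E} (he : ‖e‖ = 1) (u : (ℝ ∙ e)ᗮ) (t : ℝ) :
    hyperProj e ((u : E) + t • e) = u := by
  refine Subtype.ext ?_
  rw [coe_hyperProj he, inner_add_right, inner_coe_hyperplane, real_inner_smul_right,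
    real_inner_self_eq_norm_sq, he]
  simp

theorem inner_coe_add_smul {e : E} (he : ‖e‖ = 1) (u : (ℝ ∙ e)ᗮ) (t : ℝ) :
    ⟪e, (u : E) + t • e⟫ = t := by
  rw [inner_add_right, inner_coe_hyperplane, real_inner_smul_right,
    real_inner_self_eq_norm_sq, he]
  simp

theorem hyperProj_add_smul {e : E} (he : ‖e‖ = 1) (x : E) (t : ℝ) :
    hyperProj e (x + t • e) = hyperProj e x := by
  refine Subtype.ext ?_
  rw [coe_hyperProj he, coe_hyperProj he, inner_add_right, real_inner_smul_right,
    real_inner_self_eq_norm_sq, he]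
  module

theorem norm_hyperProj_le (e x : E) : ‖hyperProj e x‖ ≤ ‖x‖ :=
  Submodule.norm_orthogonalProjectionOnto_apply_le _ x

theorem graphDepth_add_smul {e : E} (he : ‖e‖ = 1) (g : (ℝ ∙ e)ᗮ → ℝ) (x : E) (t : ℝ) :
    graphDepth g (x + t • e) = graphDepth g x - t := by
  rw [graphDepth, graphDepth, hyperProj_add_smul he, inner_add_right, real_inner_smul_right,
    real_inner_self_eq_norm_sq, he]
  ring

theorem graphDepth_coe_add_smul {e : E} (he : ‖e‖ = 1) (g : (ℝ ∙ e)ᗮ → ℝ) (u : (ℝ ∙ e)ᗮ)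
    (t : ℝ) : graphDepth g ((u : E) + (g u - t) • e) = t := by
  rw [graphDepth, hyperProj_coe_add_smul he, inner_coe_add_smul he]
  ring

theorem coe_hyperProj_add_smul_graphDepth {e : E} (he : ‖e‖ = 1) (g : (ℝ ∙ e)ᗮ → ℝ) (x : E) :
    (hyperProj e x : E) + (g (hyperProj e x) - graphDepth g x) • e = x := by
  rw [graphDepth, sub_sub_cancel, coe_hyperProj he, sub_add_cancel]

theorem continuous_graphDepth {e : E} {g : (ℝ ∙ e)ᗮ → ℝ} (hg : Continuous g) :
    Continuous (graphDepth g) :=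
  (hg.comp (hyperProj e).continuous).sub (continuous_const.inner continuous_id)

theorem mem_range_graphMap {e : E} (he : ‖e‖ = 1) (g : (ℝ ∙ e)ᗮ → ℝ) (x : E) :
    x ∈ range (graphMap g) ↔ graphDepth g x = 0 := by
  constructor
  · rintro ⟨u, rfl⟩
    simpa [graphMap] using graphDepth_coe_add_smul he g u 0
  · intro h
    refine ⟨hyperProj e x, ?_⟩
    simpa [h, graphMap] using coe_hyperProj_add_smul_graphDepth he g x

theorem hyperProj_graphMap {e : E} (he : ‖e‖ = 1) (g : (ℝ ∙ e)ᗮ → ℝ) (u : (ℝ ∙ e)ᗮ) :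
    hyperProj e (graphMap g u) = u :=
  hyperProj_coe_add_smul he u (g u)

/-- The orthogonal projection is a left inverse of `graphMap g` and does not increase distances.
This is the hypothesis of the area formula. -/
theorem dist_le_dist_graphMap {e : E} (he : ‖e‖ = 1) (g : (ℝ ∙ e)ᗮ → ℝ) (u v : (ℝ ∙ e)ᗮ) :
    dist u v ≤ dist (graphMap g u) (graphMap g v) := by
  rw [dist_eq_norm, dist_eq_norm]
  refine le_trans (le_of_eq ?_) (norm_hyperProj_le e _)
  rw [map_sub, hyperProj_graphMap he, hyperProj_graphMap he]

theorem lipschitzWith_graphMap {e : E} (he : ‖e‖ = 1) {g : (ℝ ∙ e)ᗮ → ℝ} {K : ℝ≥0}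
    (hg : LipschitzWith K g) : LipschitzWith (1 + K) (graphMap g) := by
  refine (LipschitzWith.subtype_val _).add (LipschitzWith.of_dist_le_mul fun u v => ?_)
  rw [dist_eq_norm, ← sub_smul, norm_smul, he, mul_one]
  simpa [dist_eq_norm] using hg.norm_sub_le u v

theorem hasFDerivAt_graphMap {e : E} {g : (ℝ ∙ e)ᗮ → ℝ} {u : (ℝ ∙ e)ᗮ}
    (hg : DifferentiableAt ℝ g u) :
    HasFDerivAt (graphMap g) ((ℝ ∙ e)ᗮ.subtypeL + (fderiv ℝ g u).smulRight e) u :=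
  (ℝ ∙ e)ᗮ.subtypeL.hasFDerivAt.add (hg.hasFDerivAt.smul_const e)

/-- With `a` the Riesz vector of `L`, the operator `AᵀA` is the transvection `v ↦ v + L(v) a`, whose
determinant is `1 + L(a) = 1 + ‖L‖²`. -/
theorem normDet_subtypeL_add_smulRight {e : E} (he : ‖e‖ = 1) (L : (ℝ ∙ e)ᗮ →L[ℝ] ℝ) :
    (((ℝ ∙ e)ᗮ.subtypeL + L.smulRight e : (ℝ ∙ e)ᗮ →L[ℝ] E) : (ℝ ∙ e)ᗮ →ₗ[ℝ] E).normDet =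
      Real.sqrt (1 + ‖L‖ ^ 2) := by
  set A : (ℝ ∙ e)ᗮ →L[ℝ] E := (ℝ ∙ e)ᗮ.subtypeL + L.smulRight e with hA
  set a : (ℝ ∙ e)ᗮ := (InnerProductSpace.toDual ℝ _).symm L with ha
  have hLa : ∀ v, ⟪a, v⟫ = L v := fun v => InnerProductSpace.toDual_symm_apply
  have h1 := A.normDet_sq
  simp only [RCLike.ofReal_real_eq_id, id] at h1
  have h2 : ((A.adjoint ∘L A : (ℝ ∙ e)ᗮ →L[ℝ] (ℝ ∙ e)ᗮ) : (ℝ ∙ e)ᗮ →ₗ[ℝ] (ℝ ∙ e)ᗮ) =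
      LinearMap.transvection (L : (ℝ ∙ e)ᗮ →ₗ[ℝ] ℝ) a := by
    refine LinearMap.ext fun v => ext_inner_right ℝ fun w => ?_
    rw [LinearMap.transvection.apply, inner_add_left, real_inner_smul_left, hLa]
    change ⟪A.adjoint (A v), w⟫ = _
    rw [ContinuousLinearMap.adjoint_inner_left]
    have hAv : ∀ v, A v = (v : E) + L v • e := fun v => rfl
    rw [hAv, hAv, inner_add_left, inner_add_right, inner_add_right, real_inner_smul_left,
      real_inner_smul_left, real_inner_smul_right, real_inner_smul_right, inner_coe_hyperplane,
      real_inner_comm e (v : E), inner_coe_hyperplane, real_inner_self_eq_norm_sq, he]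
    simp
  have h3 : (A.adjoint ∘L A).det = 1 + ‖L‖ ^ 2 := by
    rw [ContinuousLinearMap.det, h2, LinearMap.transvection.det]
    have h4 : L a = ‖L‖ ^ 2 := by
      rw [← hLa, real_inner_self_eq_norm_sq, ha, LinearIsometryEquiv.norm_map]
    exact congrArg (1 + ·) h4
  rw [← h3, ← h1, Real.sqrt_sq (LinearMap.normDet_nonneg _)]

variable [MeasurableSpace E] [BorelSpace E]

theorem measurableEmbedding_graphMap {e : E} (he : ‖e‖ = 1) {g : (ℝ ∙ e)ᗮ → ℝ} {K : ℝ≥0}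
    (hg : LipschitzWith K g) : MeasurableEmbedding (graphMap g) :=
  ((AntilipschitzWith.of_le_mul_dist (K := 1) fun u v => by
    simpa using dist_le_dist_graphMap he g u v).isClosedEmbedding
    (lipschitzWith_graphMap he hg).uniformContinuous).measurableEmbedding

/-- The surface measure of a Lipschitz graph. -/
theorem restrict_range_graphMap {e : E} (he : ‖e‖ = 1) {g : (ℝ ∙ e)ᗮ → ℝ} {K : ℝ≥0}
    (hg : LipschitzWith K g) :
    (μHE[finrank ℝ (ℝ ∙ e)ᗮ] : Measure E).restrict (range (graphMap g)) =
      (volume.withDensity fun u => ENNReal.ofReal (Real.sqrt (1 + ‖fderiv ℝ g u‖ ^ 2))).map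
        (graphMap g) := by
  have hemb := measurableEmbedding_graphMap he hg
  refine Measure.ext fun t ht => ?_
  rw [Measure.restrict_apply ht, hemb.map_apply,
    withDensity_apply _ (hemb.measurable ht), ← image_preimage_eq_inter_range,
    euclideanHausdorffMeasure_image_eq_lintegral_normDet (lipschitzWith_graphMap he hg)
      (dist_le_dist_graphMap he g) (hemb.measurable ht)]
  refine lintegral_congr_ae ?_
  filter_upwards [ae_restrict_of_ae hg.ae_differentiableAt] with u hu
  rw [(hasFDerivAt_graphMap hu).fderiv, normDet_subtypeL_add_smulRight he]

theorem measurable_graph_density {e : E} (g : (ℝ ∙ e)ᗮ → ℝ) :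
    Measurable fun u => ENNReal.ofReal (Real.sqrt (1 + ‖fderiv ℝ g u‖ ^ 2)) :=
  (Real.continuous_sqrt.measurable.comp
    (((measurable_fderiv ℝ g).norm.pow_const 2).const_add 1)).ennreal_ofReal

theorem integrableOn_range_graphMap_iff {e : E} (he : ‖e‖ = 1) {g : (ℝ ∙ e)ᗮ → ℝ} {K : ℝ≥0}
    (hg : LipschitzWith K g) (f : E → ℝ) :
    IntegrableOn f (range (graphMap g)) μHE[finrank ℝ (ℝ ∙ e)ᗮ] ↔
      Integrable fun u => Real.sqrt (1 + ‖fderiv ℝ g u‖ ^ 2) * f (graphMap g u) := by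
  rw [IntegrableOn, restrict_range_graphMap he hg,
    (measurableEmbedding_graphMap he hg).integrable_map_iff,
    integrable_withDensity_iff_integrable_smul' (measurable_graph_density g)
      (Eventually.of_forall fun _ => ENNReal.ofReal_lt_top)]
  simp only [ENNReal.toReal_ofReal (Real.sqrt_nonneg _), smul_eq_mul, Function.comp_apply]

theorem setIntegral_range_graphMap {e : E} (he : ‖e‖ = 1) {g : (ℝ ∙ e)ᗮ → ℝ} {K : ℝ≥0}
    (hg : LipschitzWith K g) (f : E → ℝ) :
    ∫ x in range (graphMap g), f x ∂μHE[finrank ℝ (ℝ ∙ e)ᗮ] =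
      ∫ u, Real.sqrt (1 + ‖fderiv ℝ g u‖ ^ 2) * f (graphMap g u) := by
  rw [restrict_range_graphMap he hg, (measurableEmbedding_graphMap he hg).integral_map,
    integral_withDensity_eq_integral_toReal_smul (measurable_graph_density g)
      (Eventually.of_forall fun _ => ENNReal.ofReal_lt_top)]
  simp only [ENNReal.toReal_ofReal (Real.sqrt_nonneg _), smul_eq_mul]

/-- The volume in graph coordinates. -/
theorem measurePreserving_graph_coordinates {e : E} (he : ‖e‖ = 1) {g : (ℝ ∙ e)ᗮ → ℝ}
    (hg : Continuous g) :
    MeasurePreserving (fun p : (ℝ ∙ e)ᗮ × ℝ => (p.1 : E) + (g p.1 - p.2) • e) := by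
  -- A shear composed with a reflection of the fibres; the orthogonal splitting `E = eᗮ ⊕ ℝ e` then
  -- gives the volume on `E`.
  have h1 : MeasurePreserving (fun p : (ℝ ∙ e)ᗮ × ℝ => (p.1, g p.1 - p.2)) := by
    refine MeasurePreserving.skew_product (g := fun u t => g u - t) (MeasurePreserving.id _) ?_ ?_
    · exact ((hg.comp continuous_fst).sub continuous_snd).measurable
    · exact Eventually.of_forall fun u => (Measure.measurePreserving_sub_left volume (g u)).map_eq
  have h2 : MeasurePreserving (fun p : (ℝ ∙ e)ᗮ × ℝ => (p.1 : E) + p.2 • e) := by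
    let φ : ℝ ≃ₗᵢ[ℝ] (ℝ ∙ e) := LinearIsometryEquiv.toSpanUnitSingleton e he
    have h3 := ((ℝ ∙ e).measurePreserving_measurableEquivProd (0 : E)).symm
    rw [InnerProductSpace.euclideanHausdorffMeasure_eq_volume] at h3
    have h4 := (φ.measurePreserving.prod (MeasurePreserving.id (volume : Measure (ℝ ∙ e)ᗮ)))
    have h5 := h3.comp (h4.comp Measure.measurePreserving_swap)
    convert h5 using 2 with p
    · simp [φ, LinearIsometryEquiv.toSpanUnitSingleton, add_comm]
    · rfl
  exact h2.comp h1

end GraphMap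

/-! ### Graph charts of a Lipschitz domain and the outer normal. -/

section OuterNormal

open Set Filter Metric Module
open scoped NNReal ENNReal RealInnerProductSpace

variable {n : ℕ}

/-- In the open set `O`, the set `Ω` is the region below the Lipschitz graph of `g`. -/
structure IsGraphChart (Ω O : Set (Vec n)) (e : Vec n) (g : (ℝ ∙ e)ᗮ → ℝ) (K : ℝ≥0) : Prop where
  isOpen : IsOpen O
  norm_eq : ‖e‖ = 1
  lipschitz : LipschitzWith K g
  mem_iff : ∀ x ∈ O, x ∈ Ω ↔ 0 < graphDepth g x

theorem IsLipschitzDomain.exists_isGraphChart {Ω : Set (Vec n)} (hΩ : IsLipschitzDomain Ω)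
    {p : Vec n} (hp : p ∈ frontier Ω) :
    ∃ (O : Set (Vec n)) (e : Vec n) (g : (ℝ ∙ e)ᗮ → ℝ) (K : ℝ≥0),
      p ∈ O ∧ IsGraphChart Ω O e g K := by
  obtain ⟨e, g, K, V, he, hg, hinv, hV, hmem⟩ := hΩ.2.2 p hp
  refine ⟨interior V, e, fun u => g u, K, mem_interior_iff_mem_nhds.2 hV, isOpen_interior, he,
    hg.comp (LipschitzWith.subtype_val _) |>.weaken (by simp), fun x hx => ?_⟩
  rw [hmem x (interior_subset hx), graphDepth, sub_pos, coe_hyperProj he, sub_eq_add_neg,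
    ← neg_smul, hinv]

variable {Ω O : Set (Vec n)} {e : Vec n} {g : (ℝ ∙ e)ᗮ → ℝ} {K : ℝ≥0}

namespace IsGraphChart

theorem mem_closure_iff (h : IsGraphChart Ω O e g K) {x : Vec n} (hx : x ∈ O) :
    x ∈ closure Ω ↔ 0 ≤ graphDepth g x := by
  have hc := continuous_graphDepth (e := e) h.lipschitz.continuous
  constructor
  · intro hx'
    by_contra! hlt
    obtain ⟨z, hz, hzΩ⟩ := _root_.mem_closure_iff.1 hx' _
      (h.isOpen.inter (hc.isOpen_preimage _ isOpen_Iio)) ⟨hx, hlt⟩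
    exact absurd ((h.mem_iff z hz.1).1 hzΩ) (not_lt.2 (le_of_lt hz.2))
  · intro hx'
    have hl : Tendsto (fun t : ℝ => x + (-t) • e) (𝓝[>] 0) (𝓝 x) := by
      have : Continuous fun t : ℝ => x + (-t) • e := by fun_prop
      simpa using this.continuousWithinAt.tendsto (x := (0 : ℝ)) (s := Ioi 0)
    refine mem_closure_of_tendsto hl ?_
    filter_upwards [hl (h.isOpen.mem_nhds hx), self_mem_nhdsWithin] with t ht ht0
    rw [h.mem_iff _ ht, graphDepth_add_smul h.norm_eq]
    have : (0 : ℝ) < t := ht0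
    linarith

theorem mem_frontier_iff (h : IsGraphChart Ω O e g K) (hΩ : IsOpen Ω) {x : Vec n} (hx : x ∈ O) :
    x ∈ frontier Ω ↔ graphDepth g x = 0 := by
  rw [hΩ.frontier_eq, Set.mem_sdiff, h.mem_closure_iff hx, h.mem_iff x hx, not_lt, eq_comm]
  exact ⟨fun hh => le_antisymm hh.1 hh.2, fun hh => ⟨hh.le, hh.ge⟩⟩

theorem frontier_inter_eq (h : IsGraphChart Ω O e g K) (hΩ : IsOpen Ω) :
    frontier Ω ∩ O = range (graphMap g) ∩ O := by
  ext x
  refine and_congr_left fun hx => ?_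
  rw [h.mem_frontier_iff hΩ hx, mem_range_graphMap h.norm_eq]

/-- Near `x`, the domain contains the open convex cone with apex `x` about `-e` whose slope is given
by the Lipschitz constant. Unique differentiability is what makes `fderivWithin ℝ y (closure Ω)`
continuous up to the boundary. -/
theorem uniqueDiffWithinAt (h : IsGraphChart Ω O e g K) (hΩ : IsOpen Ω) {x : Vec n} (hx : x ∈ O)
    (hx' : x ∈ frontier Ω) : UniqueDiffWithinAt ℝ (closure Ω) x := by
  let f : Vec n → ℝ := fun z => ⟪e, z - x⟫ + K * ‖hyperProj e (z - x)‖
  have hfc : Continuous f := by fun_prop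
  have hconv : Convex ℝ {z | f z < 0} := by
    have h1 : ConvexOn ℝ univ f := by
      refine ⟨convex_univ, fun a _ b _ s t hs ht hst => ?_⟩
      have hab : s • a + t • b - x = s • (a - x) + t • (b - x) := by
        have : x = s • x + t • x := by rw [← add_smul, hst, one_smul]
        nth_rewrite 1 [this]
        module
      have h2 : ‖hyperProj e (s • (a - x) + t • (b - x))‖ ≤
          s * ‖hyperProj e (a - x)‖ + t * ‖hyperProj e (b - x)‖ := by
        rw [map_add, map_smul, map_smul]
        refine (norm_add_le _ _).trans_eq ?_
        rw [norm_smul, norm_smul, Real.norm_of_nonneg hs, Real.norm_of_nonneg ht]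
      have h3 := mul_le_mul_of_nonneg_left h2 K.2
      simp only [f, hab, inner_add_right, real_inner_smul_right, smul_eq_mul]
      have h4 : (K : ℝ) * (s * ‖hyperProj e (a - x)‖ + t * ‖hyperProj e (b - x)‖) =
        s * (K * ‖hyperProj e (a - x)‖) + t * (K * ‖hyperProj e (b - x)‖) := by ring
      have h5 : (K : ℝ) * ‖hyperProj e (s • (a - x) + t • (b - x))‖ ≤
        (K : ℝ) * (s * ‖hyperProj e (a - x)‖ + t * ‖hyperProj e (b - x)‖) := h3
      linarith
    simpa using h1.convex_lt 0
  have hopen : IsOpen {z | f z < 0} := isOpen_lt hfc continuous_const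
  have hft : ∀ t : ℝ, f (x + t • e) = t := by
    intro t
    have h1 : hyperProj e (t • e) = 0 := by
      simpa using hyperProj_coe_add_smul h.norm_eq 0 t
    simp only [f, add_sub_cancel_left, h1, norm_zero, mul_zero, add_zero, real_inner_smul_right,
      real_inner_self_eq_norm_sq, h.norm_eq]
    ring
  have hne : (interior {z | f z < 0}).Nonempty := by
    rw [hopen.interior_eq]
    exact ⟨x + (-1 : ℝ) • e, by simp only [mem_ofPred_eq, hft]; norm_num⟩
  have hxc : x ∈ closure {z | f z < 0} := by
    have hl : Tendsto (fun t : ℝ => x + t • e) (𝓝[<] 0) (𝓝 x) := by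
      have : Continuous fun t : ℝ => x + t • e := by fun_prop
      simpa using this.continuousWithinAt.tendsto (x := (0 : ℝ)) (s := Iio 0)
    refine mem_closure_of_tendsto hl ?_
    filter_upwards [self_mem_nhdsWithin] with t ht
    have ht0 : t < 0 := ht
    simpa only [mem_ofPred_eq, hft] using ht0
  refine ((uniqueDiffWithinAt_convex hconv hne hxc).inter (h.isOpen.mem_nhds hx)).mono ?_
  rintro z ⟨hz, hzO⟩
  refine subset_closure ((h.mem_iff z hzO).2 ?_)
  have h0 := (h.mem_frontier_iff hΩ hx).1 hx'
  have h1 := h.lipschitz.norm_sub_le (hyperProj e z) (hyperProj e x)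
  rw [← map_sub] at h1
  have h2 := (abs_le.1 ((Real.norm_eq_abs _).symm.le.trans h1)).1
  have h3 : f z < 0 := hz
  simp only [f, inner_sub_right] at h3
  simp only [graphDepth] at h0 ⊢
  linarith

end IsGraphChart

theorem IsLipschitzDomain.uniqueDiffOn_closure (hΩ : IsLipschitzDomain Ω) :
    UniqueDiffOn ℝ (closure Ω) := by
  intro x hx
  by_cases hxΩ : x ∈ Ω
  · exact (hΩ.1.uniqueDiffWithinAt hxΩ).mono subset_closure
  · have hxf : x ∈ frontier Ω := by rw [hΩ.1.frontier_eq]; exact ⟨hx, hxΩ⟩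
    obtain ⟨O, e, g, K, hxO, hO⟩ := hΩ.exists_isGraphChart hxf
    exact hO.uniqueDiffWithinAt hΩ.1 hxO hxf

/-- For two distinct normals, a small step in the direction `ν' - ν` points inwards for `ν` and
outwards for `ν'`, so its endpoint would lie both in and out of `Ω`. -/
theorem IsOuterNormal.unique {x ν ν' : Vec n} (h : IsOuterNormal Ω x ν)
    (h' : IsOuterNormal Ω x ν') : ν = ν' := by
  by_contra hne
  have h1 : ⟪ν, ν'⟫ < 1 := by
    refine lt_of_le_of_ne ?_ fun hh => hne ((inner_eq_one_iff_of_norm_eq_one h.1 h'.1).1 hh)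
    simpa [h.1, h'.1] using real_inner_le_norm ν ν'
  set w := ν' - ν with hw
  have hw0 : 0 < ‖w‖ := norm_pos_iff.2 (sub_ne_zero.2 (Ne.symm hne))
  have ha : ⟪w, ν⟫ = -(1 - ⟪ν, ν'⟫) := by
    rw [hw, inner_sub_left, real_inner_self_eq_norm_sq, h.1, real_inner_comm]; ring
  have hb : ⟪w, ν'⟫ = 1 - ⟪ν, ν'⟫ := by
    rw [hw, inner_sub_left, real_inner_self_eq_norm_sq, h'.1]; ring
  set a := 1 - ⟪ν, ν'⟫ with haa
  have ha0 : 0 < a := by linarith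
  set ε := a / (2 * ‖w‖) with hε
  have hε0 : 0 < ε := by positivity
  have hεw : ε * ‖w‖ = a / 2 := by rw [hε]; field_simp
  obtain ⟨δ, hδ, hd⟩ := h.2 ε hε0
  obtain ⟨δ', hδ', hd'⟩ := h'.2 ε hε0
  set t := min δ δ' / (2 * ‖w‖) with ht
  have ht0 : 0 < t := by positivity
  have htw : ‖x + t • w - x‖ = t * ‖w‖ := by
    rw [add_sub_cancel_left, norm_smul, Real.norm_of_nonneg ht0.le]
  have htw' : t * ‖w‖ = min δ δ' / 2 := by rw [ht]; field_simp
  have hm : 0 < min δ δ' := lt_min hδ hδ'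
  have h3 := (hd (x + t • w) (by rw [htw, htw']; linarith [min_le_left δ δ'])).1
  have h4 := (hd' (x + t • w) (by rw [htw, htw']; linarith [min_le_right δ δ'])).2
  rw [htw, add_sub_cancel_left, real_inner_smul_left, ha] at h3
  rw [htw, add_sub_cancel_left, real_inner_smul_left, hb] at h4
  have hta : 0 < t * a := by positivity
  have hεt : ε * (t * ‖w‖) = t * a / 2 := by rw [mul_left_comm, hεw]; ring
  refine h4 ?_ (h3 ?_)
  · rw [hεt]; linarith
  · rw [neg_mul, hεt]; linarith

theorem IsOuterNormal.outerNormal_eq {x ν : Vec n} (h : IsOuterNormal Ω x ν) :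
    outerNormal Ω x = ν := by
  have hex : ∃ ν, IsOuterNormal Ω x ν := ⟨ν, h⟩
  rw [outerNormal, dif_pos hex]
  exact hex.choose_spec.unique h

/-- The normal is `e - ∇g` normalized, and its length is the area density of the graph. The product
is stated because the square roots then cancel in flux integrals. -/
theorem IsGraphChart.smul_innerSL_outerNormal (h : IsGraphChart Ω O e g K) {u : (ℝ ∙ e)ᗮ}
    (hu : graphMap g u ∈ O) (hg : DifferentiableAt ℝ g u) :
    Real.sqrt (1 + ‖fderiv ℝ g u‖ ^ 2) • innerSL ℝ (outerNormal Ω (graphMap g u)) =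
      innerSL ℝ e - (fderiv ℝ g u).comp (hyperProj e) := by
  set c := Real.sqrt (1 + ‖fderiv ℝ g u‖ ^ 2) with hc
  have hc1 : 1 ≤ c := by rw [hc, Real.one_le_sqrt]; nlinarith [sq_nonneg ‖fderiv ℝ g u‖]
  have hc0 : 0 < c := by linarith
  set a : (ℝ ∙ e)ᗮ := (InnerProductSpace.toDual ℝ _).symm (fderiv ℝ g u) with ha
  have hga : ∀ v, ⟪a, v⟫ = fderiv ℝ g u v := fun v => InnerProductSpace.toDual_symm_apply
  set N : Vec n := e - a with hN
  have hinner : ∀ v, ⟪N, v⟫ = ⟪e, v⟫ - fderiv ℝ g u (hyperProj e v) := by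
    intro v
    rw [hN, inner_sub_left, ← hga, Submodule.coe_inner, coe_hyperProj h.norm_eq, inner_sub_right,
      real_inner_smul_right, real_inner_comm e (a : Vec n), inner_coe_hyperplane]
    ring
  have han : ‖(a : Vec n)‖ = ‖fderiv ℝ g u‖ := by
    change ‖a‖ = _
    rw [ha, LinearIsometryEquiv.norm_map]
  have hNn : ‖N‖ = c := by
    rw [hc, ← Real.sqrt_sq (norm_nonneg N), hN, norm_sub_sq_real, inner_coe_hyperplane, h.norm_eq,
      han]
    congr 1; ring
  suffices hν : IsOuterNormal Ω (graphMap g u) (c⁻¹ • N) by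
    rw [hν.outerNormal_eq, ← map_smul, smul_smul, mul_inv_cancel₀ hc0.ne', one_smul]
    ext v
    simpa using hinner v
  refine ⟨by rw [norm_smul, hNn, Real.norm_of_nonneg (by positivity), inv_mul_cancel₀ hc0.ne'],
    fun ε hε => ?_⟩
  have hlo := hg.hasFDerivAt.isLittleO.def (half_pos hε)
  obtain ⟨δ₁, hδ₁, h1⟩ := Metric.eventually_nhds_iff_ball.1 hlo
  obtain ⟨δ₂, hδ₂, h2⟩ := Metric.isOpen_iff.1 h.isOpen _ hu
  refine ⟨min δ₁ δ₂, lt_min hδ₁ hδ₂, fun z hz => ?_⟩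
  set x := graphMap g u with hx
  have hzO : z ∈ O := h2 (mem_ball_iff_norm.2 (hz.trans_le (min_le_right _ _)))
  have hpx : hyperProj e x = u := hyperProj_graphMap h.norm_eq g u
  have hpz : hyperProj e z - u = hyperProj e (z - x) := by rw [map_sub, hpx]
  have hle := norm_hyperProj_le e (z - x)
  have h3 := h1 (hyperProj e z) (by
    rw [mem_ball_iff_norm, hpz]
    exact hle.trans_lt (hz.trans_le (min_le_left _ _)))
  rw [hpz, Real.norm_eq_abs] at h3
  have h3' : |g (hyperProj e z) - g u - fderiv ℝ g u (hyperProj e (z - x))| ≤ ε / 2 * ‖z - x‖ :=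
    h3.trans (by gcongr)
  have hdx : graphDepth g x = 0 := (mem_range_graphMap h.norm_eq g x).1 ⟨u, rfl⟩
  -- To first order the depth is `-⟪N, z - x⟫`. The error is at most `ε / 2 * ‖z - x‖`, and `‖N‖ = c
  -- ≥ 1`, so the cone condition decides the sign.
  have hdz : graphDepth g z =
      (g (hyperProj e z) - g u - fderiv ℝ g u (hyperProj e (z - x))) - ⟪N, z - x⟫ := by
    rw [hinner, inner_sub_right]
    rw [graphDepth, hpx] at hdx
    rw [graphDepth]
    linarith
  have hNν : ⟪N, z - x⟫ = c * ⟪z - x, c⁻¹ • N⟫ := by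
    rw [real_inner_smul_right, real_inner_comm, mul_inv_cancel_left₀ hc0.ne']
  rw [h.mem_iff z hzO, hdz, hNν]
  obtain ⟨h4, h5⟩ := abs_le.1 h3'
  have hz0 := norm_nonneg (z - x)
  have hεz : 0 ≤ ε * ‖z - x‖ := by positivity
  constructor
  · intro h6
    have h7 : c * ⟪z - x, c⁻¹ • N⟫ ≤ ⟪z - x, c⁻¹ • N⟫ := by nlinarith
    linarith
  · intro h6
    have h7 : ⟪z - x, c⁻¹ • N⟫ ≤ c * ⟪z - x, c⁻¹ • N⟫ := by nlinarith
    linarith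

end OuterNormal

/-! ### Thin layers below a Lipschitz graph. -/

section BoundaryLayer

open Set Filter Metric Module
open scoped NNReal ENNReal RealInnerProductSpace

/-- Since `∫ η' = 1`, the functions `η'(depth / h) / h` have unit mass in the depth variable.
Vanishing up to 1, and not only up to 0, keeps the support of the cut-off test function at depth at
least `h`, hence inside `Ω`. -/
theorem exists_smooth_cutoff : ∃ (η : ℝ → ℝ) (L : ℝ≥0), ContDiff ℝ 1 η ∧ LipschitzWith L η ∧
    (∀ t, 0 ≤ η t) ∧ (∀ t, η t ≤ 1) ∧ (∀ t ≤ 1, η t = 0) ∧ (∀ t, 2 ≤ t → η t = 1) ∧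
    (∀ t ≤ 0, deriv η t = 0) ∧ HasCompactSupport (deriv η) ∧ ∫ t, deriv η t = 1 := by
  let η : ℝ → ℝ := fun t => Real.smoothTransition (t - 1)
  have hη : ContDiff ℝ 1 η :=
    (Real.smoothTransition.contDiff (n := 1)).comp (contDiff_id.sub contDiff_const)
  have h0 : ∀ t ≤ 1, η t = 0 := fun t ht =>
    Real.smoothTransition.zero_of_nonpos (by linarith)
  have h1 : ∀ t, 2 ≤ t → η t = 1 := fun t ht =>
    Real.smoothTransition.one_of_one_le (by linarith)
  have hd0 : ∀ t < 1, deriv η t = 0 := by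
    intro t ht
    have : η =ᶠ[𝓝 t] fun _ => 0 := by
      filter_upwards [Iio_mem_nhds ht] with s hs using h0 s (le_of_lt hs)
    simpa using this.deriv_eq
  have hd1 : ∀ t, 2 < t → deriv η t = 0 := by
    intro t ht
    have : η =ᶠ[𝓝 t] fun _ => 1 := by
      filter_upwards [Ioi_mem_nhds ht] with s hs using h1 s (le_of_lt hs)
    simpa using this.deriv_eq
  have hcs : HasCompactSupport (deriv η) := by
    refine HasCompactSupport.intro (isCompact_Icc (a := (1 : ℝ)) (b := 2)) fun t ht => ?_
    by_contra hne
    exact ht ⟨not_lt.1 fun h => hne (hd0 t h), not_lt.1 fun h => hne (hd1 t h)⟩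
  have hdc : Continuous (deriv η) := hη.continuous_deriv le_rfl
  obtain ⟨C, hC⟩ := hcs.exists_bound_of_continuous hdc
  refine ⟨η, ⟨C, (norm_nonneg _).trans (hC 0)⟩, hη, ?_, fun t => Real.smoothTransition.nonneg _,
    fun t => Real.smoothTransition.le_one _, h0, h1, fun t ht => hd0 t (by linarith), hcs, ?_⟩
  · exact lipschitzWith_of_nnnorm_deriv_le (hη.differentiable one_ne_zero) fun t => hC t
  · rw [integral_of_hasDerivAt_of_tendsto (f := η) (m := 0) (n := 1)
      (fun t => ((hη.differentiable one_ne_zero) t).hasDerivAt)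
      (hdc.integrable_of_hasCompactSupport hcs) ?_ ?_]
    · norm_num
    · exact tendsto_const_nhds.congr' (by
        filter_upwards [eventually_le_atBot 1] with t ht using (h0 t ht).symm)
    · exact tendsto_const_nhds.congr' (by
        filter_upwards [eventually_ge_atTop 2] with t ht using (h1 t ht).symm)

theorem LipschitzWith.real_mul_of_bounded {X : Type*} [PseudoMetricSpace X] {f g : X → ℝ}
    {Kf Kg Mf Mg : ℝ≥0} (hf : LipschitzWith Kf f) (hg : LipschitzWith Kg g)
    (hMf : ∀ x, ‖f x‖ ≤ Mf) (hMg : ∀ x, ‖g x‖ ≤ Mg) :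
    LipschitzWith (Kf * Mg + Mf * Kg) fun x => f x * g x := by
  refine LipschitzWith.of_dist_le_mul fun x y => ?_
  have h1 := hf.dist_le_mul x y
  have h2 := hg.dist_le_mul x y
  rw [dist_eq_norm] at h1 h2 ⊢
  have h3 : f x * g x - f y * g y = (f x - f y) * g x + f y * (g x - g y) := by ring
  rw [h3]
  refine (norm_add_le _ _).trans ?_
  rw [norm_mul, norm_mul]
  push_cast
  have h4 := mul_le_mul h1 (hMg x) (norm_nonneg _) (by positivity)
  have h5 := mul_le_mul (hMf y) h2 (norm_nonneg _) (by positivity)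
  linarith

theorem integrable_of_bounded_of_isCompact {X : Type*} [TopologicalSpace X] [T2Space X]
    [MeasurableSpace X] [BorelSpace X] {μ : Measure X} [IsFiniteMeasureOnCompacts μ] {F : X → ℝ}
    {T : Set X} (hT : IsCompact T) {C : ℝ} (hF : AEStronglyMeasurable F μ)
    (hC : ∀ᵐ x ∂μ, ‖F x‖ ≤ C) (h0 : ∀ x ∉ T, F x = 0) : Integrable F μ := by
  rw [← integrableOn_iff_integrable_of_support_subset (s := T)
    (fun x hx => by_contra fun hxT => hx (h0 x hxT))]
  exact Measure.integrableOn_of_bounded hT.measure_lt_top.ne hF (ae_restrict_of_ae hC)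

variable {E : Type*} [NormedAddCommGroup E] [InnerProductSpace ℝ E] [FiniteDimensional ℝ E]
  [MeasurableSpace E] [BorelSpace E]

/-- The conormal `e - ∇g` of the graph of `g`, not normalized. -/
noncomputable def conormal {e : E} (g : (ℝ ∙ e)ᗮ → ℝ) (u : (ℝ ∙ e)ᗮ) : E →L[ℝ] ℝ :=
  innerSL ℝ e - (fderiv ℝ g u).comp (hyperProj e)

variable {e : E} {g : (ℝ ∙ e)ᗮ → ℝ} {K : ℝ≥0}

theorem measurable_conormal (g : (ℝ ∙ e)ᗮ → ℝ) : Measurable (conormal g) := by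
  have h : Continuous fun L : (ℝ ∙ e)ᗮ →L[ℝ] ℝ => innerSL ℝ e - L.comp (hyperProj e) := by
    fun_prop
  exact h.measurable.comp (measurable_fderiv ℝ g)

theorem norm_conormal_le (he : ‖e‖ = 1) (hg : LipschitzWith K g) (u : (ℝ ∙ e)ᗮ) :
    ‖conormal g u‖ ≤ 1 + K := by
  refine ContinuousLinearMap.opNorm_le_bound _ (by positivity) fun v => ?_
  have h1 : ‖⟪e, v⟫‖ ≤ ‖v‖ := by simpa [he] using norm_inner_le_norm (𝕜 := ℝ) e v
  have h2 : ‖fderiv ℝ g u (hyperProj e v)‖ ≤ K * ‖v‖ :=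
    ((fderiv ℝ g u).le_opNorm _).trans
      (mul_le_mul (norm_fderiv_le_of_lipschitz ℝ hg) (norm_hyperProj_le e v) (norm_nonneg _) K.2)
  have h3 : conormal g u v = ⟪e, v⟫ - fderiv ℝ g u (hyperProj e v) := rfl
  rw [h3]
  linarith [norm_sub_le ⟪e, v⟫ (fderiv ℝ g u (hyperProj e v))]

theorem hasFDerivAt_graphDepth {x : E} (hg : DifferentiableAt ℝ g (hyperProj e x)) :
    HasFDerivAt (graphDepth g) (-conormal g (hyperProj e x)) x := by
  have h := (hg.hasFDerivAt.comp x (hyperProj e).hasFDerivAt).sub (innerSL ℝ e).hasFDerivAt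
  rw [conormal, neg_sub]
  exact h

theorem lipschitzWith_graphDepth (he : ‖e‖ = 1) (hg : LipschitzWith K g) :
    LipschitzWith (1 + K) (graphDepth g) := by
  refine LipschitzWith.of_dist_le_mul fun x y => ?_
  have h1 : ‖⟪e, x - y⟫‖ ≤ ‖x - y‖ := by simpa [he] using norm_inner_le_norm (𝕜 := ℝ) e (x - y)
  have h2 := (hg.norm_sub_le (hyperProj e x) (hyperProj e y))
  rw [← map_sub] at h2
  have h3 := mul_le_mul_of_nonneg_left (norm_hyperProj_le e (x - y)) K.2
  have h4 : graphDepth g x - graphDepth g y =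
      (g (hyperProj e x) - g (hyperProj e y)) - ⟪e, x - y⟫ := by
    rw [graphDepth, graphDepth, inner_sub_right]; ring
  rw [dist_eq_norm, dist_eq_norm, h4]
  have h5 : (K : ℝ) * ‖hyperProj e (x - y)‖ ≤ K * ‖x - y‖ := h3
  push_cast
  linarith [norm_sub_le (g (hyperProj e x) - g (hyperProj e y)) ⟪e, x - y⟫]

theorem measurableEmbedding_graph_coordinates (he : ‖e‖ = 1) (hg : Continuous g) :
    MeasurableEmbedding (fun p : (ℝ ∙ e)ᗮ × ℝ => (p.1 : E) + (g p.1 - p.2) • e) := by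
  refine Continuous.measurableEmbedding (by fun_prop) fun p q hpq => ?_
  have h1 := congrArg (hyperProj e) hpq
  have h2 := congrArg (graphDepth g) hpq
  simp only [hyperProj_coe_add_smul he, graphDepth_coe_add_smul he] at h1 h2
  exact Prod.ext h1 h2

/-- In graph coordinates the exceptional set is a null set times `ℝ`. It justifies the chain rule
for `graphDepth g` almost everywhere in the volume. -/
theorem ae_differentiableAt_comp_hyperProj (he : ‖e‖ = 1) (hg : LipschitzWith K g) :
    ∀ᵐ x : E, DifferentiableAt ℝ g (hyperProj e x) := by
  have hm : MeasurableSet {u | ¬ DifferentiableAt ℝ g u} :=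
    (measurableSet_of_differentiableAt ℝ g).compl
  have hmp := measurePreserving_graph_coordinates he hg.continuous
  change volume (hyperProj e ⁻¹' {u | ¬ DifferentiableAt ℝ g u}) = 0
  rw [← hmp.measure_preimage ((hyperProj e).measurable hm).nullMeasurableSet]
  have hset : (fun p : (ℝ ∙ e)ᗮ × ℝ => (p.1 : E) + (g p.1 - p.2) • e) ⁻¹'
      (hyperProj e ⁻¹' {u | ¬ DifferentiableAt ℝ g u}) =
      {u | ¬ DifferentiableAt ℝ g u} ×ˢ univ := by
    ext p
    simp [hyperProj_coe_add_smul he]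
  have h0 : volume {u | ¬ DifferentiableAt ℝ g u} = 0 := hg.ae_differentiableAt
  have h1 : (volume : Measure ((ℝ ∙ e)ᗮ × ℝ)) ({u | ¬ DifferentiableAt ℝ g u} ×ˢ univ) = 0 := by
    rw [Measure.volume_eq_prod, Measure.prod_prod, h0, zero_mul]
  rw [← h1, ← hset]

variable {B : E → (E →L[ℝ] ℝ) →L[ℝ] ℝ} {T : Set E}

theorem exists_norm_le_of_continuousOn_halfspace (hg : Continuous g)
    (hB : ContinuousOn B {x | 0 ≤ graphDepth g x}) (hT : IsCompact T) (h0 : ∀ x ∉ T, B x = 0) :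
    ∃ M, 0 ≤ M ∧ ∀ x, 0 ≤ graphDepth g x → ‖B x‖ ≤ M := by
  have hS : IsClosed {x : E | 0 ≤ graphDepth g x} :=
    isClosed_le continuous_const (continuous_graphDepth hg)
  obtain ⟨M, hM⟩ := (hT.inter_right hS).exists_bound_of_continuousOn (f := B)
    (hB.mono inter_subset_right)
  refine ⟨max M 0, le_max_right _ _, fun x hx => ?_⟩
  by_cases hxT : x ∈ T
  · exact (hM x ⟨hxT, hx⟩).trans (le_max_left _ _)
  · rw [h0 x hxT]
    exact (ContinuousLinearMap.opNorm_zero).le.trans (le_max_right _ _)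

theorem integrable_layer (he : ‖e‖ = 1) (hg : LipschitzWith K g)
    (hB : ContinuousOn B {x | 0 ≤ graphDepth g x}) (hT : IsCompact T) (h0 : ∀ x ∉ T, B x = 0)
    {w : ℝ → ℝ} (hw : Continuous w) (hw0 : ∀ t ≤ 0, w t = 0) {C : ℝ} (hC : ∀ t, ‖w t‖ ≤ C) :
    Integrable fun x => w (graphDepth g x) * B x (conormal g (hyperProj e x)) := by
  have hdc := continuous_graphDepth (e := e) hg.continuous
  have hS : MeasurableSet {x : E | 0 ≤ graphDepth g x} := measurableSet_le measurable_const
    hdc.measurable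
  obtain ⟨M, hM0, hM⟩ := exists_norm_le_of_continuousOn_halfspace hg.continuous hB hT h0
  -- Nothing is known about `B` above the graph; the weight vanishes there, so the question is
  -- confined to nonnegative depth.
  rw [← integrableOn_iff_integrable_of_support_subset (s := {x : E | 0 ≤ graphDepth g x})
    (fun x hx => by_contra fun hxS => hx (by
      have : graphDepth g x ≤ 0 := (not_le.1 hxS).le
      simp [hw0 _ this]))]
  refine integrable_of_bounded_of_isCompact hT (C := C * (M * (1 + K))) ?_ ?_ ?_
  · refine (hw.comp hdc).aestronglyMeasurable.mul ?_
    refine aestronglyMeasurable_continuousLinearMap_apply (hB.aestronglyMeasurable hS) ?_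
    exact ((measurable_conormal g).comp (hyperProj e).measurable).aestronglyMeasurable
  · filter_upwards [ae_restrict_mem hS] with x hx
    rw [norm_mul]
    refine mul_le_mul (hC _) (((B x).le_opNorm _).trans ?_) (norm_nonneg _)
      ((norm_nonneg _).trans (hC 0))
    exact mul_le_mul (hM x hx) (norm_conormal_le he hg _) (norm_nonneg _) hM0
  · intro x hx
    simp [h0 x hx]

theorem aestronglyMeasurable_slice (he : ‖e‖ = 1) (hg : LipschitzWith K g)
    (hB : ContinuousOn B {x | 0 ≤ graphDepth g x}) {t : ℝ} (ht : 0 ≤ t) :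
    AEStronglyMeasurable (fun u : (ℝ ∙ e)ᗮ => B ((u : E) + (g u - t) • e) (conormal g u))
      volume := by
  have hgc := hg.continuous
  refine aestronglyMeasurable_continuousLinearMap_apply ?_
    (measurable_conormal g).aestronglyMeasurable
  refine (hB.comp_continuous (by fun_prop) fun u => ?_).aestronglyMeasurable
  simpa only [mem_ofPred_eq, graphDepth_coe_add_smul he] using ht

theorem norm_slice_le (he : ‖e‖ = 1) (hg : LipschitzWith K g) (h0 : ∀ x ∉ T, B x = 0) {M : ℝ}
    (hM0 : 0 ≤ M) (hM : ∀ x, 0 ≤ graphDepth g x → ‖B x‖ ≤ M) {t : ℝ} (ht : 0 ≤ t)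
    (u : (ℝ ∙ e)ᗮ) :
    ‖B ((u : E) + (g u - t) • e) (conormal g u)‖ ≤
      (hyperProj e '' T).indicator (fun _ => M * (1 + K)) u := by
  by_cases hu : u ∈ hyperProj e '' T
  · rw [indicator_of_mem hu]
    refine (ContinuousLinearMap.le_opNorm _ _).trans ?_
    exact mul_le_mul (hM _ (by rwa [graphDepth_coe_add_smul he])) (norm_conormal_le he hg u)
      (norm_nonneg _) hM0
  · rw [indicator_of_notMem hu, h0 _ fun hx => hu ⟨_, hx, hyperProj_coe_add_smul he _ _⟩]
    simp

theorem integrable_indicator_hyperProj_image (hT : IsCompact T) (C : ℝ) :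
    Integrable ((hyperProj e '' T).indicator fun _ => C) := by
  have hc : IsCompact (hyperProj e '' T) := hT.image (hyperProj e).continuous
  exact (integrable_indicator_iff hc.measurableSet).2 (integrableOn_const hc.measure_ne_top)

theorem integrable_graph (he : ‖e‖ = 1) (hg : LipschitzWith K g)
    (hB : ContinuousOn B {x | 0 ≤ graphDepth g x}) (hT : IsCompact T) (h0 : ∀ x ∉ T, B x = 0) :
    Integrable fun u => B (graphMap g u) (conormal g u) := by
  obtain ⟨M, hM0, hM⟩ := exists_norm_le_of_continuousOn_halfspace hg.continuous hB hT h0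
  have h1 := aestronglyMeasurable_slice he hg hB le_rfl
  have h2 := norm_slice_le he hg h0 hM0 hM le_rfl
  simp only [sub_zero] at h1 h2
  exact (integrable_indicator_hyperProj_image hT _).mono' h1 (Eventually.of_forall h2)

/-- Integrals over thin layers below a graph converge to the integral over the graph. -/
theorem tendsto_integral_layer (he : ‖e‖ = 1) (hg : LipschitzWith K g)
    (hB : ContinuousOn B {x | 0 ≤ graphDepth g x}) (hT : IsCompact T) (h0 : ∀ x ∉ T, B x = 0)
    {w : ℝ → ℝ} (hw : Continuous w) (hw0 : ∀ t ≤ 0, w t = 0) (hwc : HasCompactSupport w) :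
    Tendsto (fun h => ∫ x, w (graphDepth g x / h) / h * B x (conormal g (hyperProj e x)))
      (𝓝[>] 0) (𝓝 ((∫ t, w t) * ∫ u, B (graphMap g u) (conormal g u))) := by
  obtain ⟨M, hM0, hM⟩ := exists_norm_le_of_continuousOn_halfspace hg.continuous hB hT h0
  obtain ⟨C, hC⟩ := hwc.exists_bound_of_continuous hw
  -- The integral over the parallel graph at depth `t`. Dominated convergence makes it continuous
  -- down to depth 0, where it is the integral over the graph itself.
  let q : ℝ → ℝ := fun t => ∫ u : (ℝ ∙ e)ᗮ, B ((u : E) + (g u - t) • e) (conormal g u)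
  have hgc := hg.continuous
  have hqc : ContinuousOn q (Ici 0) := by
    refine continuousOn_of_dominated (fun t ht => aestronglyMeasurable_slice he hg hB ht)
      (fun t ht => Eventually.of_forall (norm_slice_le he hg h0 hM0 hM ht))
      (integrable_indicator_hyperProj_image hT _) (Eventually.of_forall fun u => ?_)
    have h1 : ContinuousOn (fun t : ℝ => B ((u : E) + (g u - t) • e)) (Ici 0) := by
      refine hB.comp (by fun_prop) fun t ht => ?_
      have ht' : 0 ≤ t := ht
      simpa only [mem_ofPred_eq, graphDepth_coe_add_smul he] using ht'
    exact h1.clm_apply continuousOn_const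
  have hqb : ∀ t, 0 ≤ t → ‖q t‖ ≤ ∫ u, (hyperProj e '' T).indicator (fun _ => M * (1 + K)) u :=
    fun t ht => norm_integral_le_of_norm_le (integrable_indicator_hyperProj_image hT _)
      (Eventually.of_forall (norm_slice_le he hg h0 hM0 hM ht))
  have hq0 : q 0 = ∫ u, B (graphMap g u) (conormal g u) := by
    simp only [q, sub_zero, graphMap]
  -- Fubini in graph coordinates, followed by the substitution `depth = h * t`, which cancels the
  -- factor `1 / h`.
  have hmain : ∀ h : ℝ, 0 < h →
      ∫ x, w (graphDepth g x / h) / h * B x (conormal g (hyperProj e x)) =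
        ∫ t, w t * q (h * t) := by
    intro h hh
    have hint : Integrable fun x =>
        w (graphDepth g x / h) / h * B x (conormal g (hyperProj e x)) := by
      refine integrable_layer (w := fun t => w (t / h) / h) (C := C / h) he hg hB hT h0
        (by fun_prop) (fun t ht => ?_) fun t => ?_
      · rw [hw0 _ (div_nonpos_of_nonpos_of_nonneg ht hh.le), zero_div]
      · rw [norm_div, Real.norm_of_nonneg hh.le]
        gcongr
        exact hC _
    have hmp := measurePreserving_graph_coordinates he hgc
    have hme := measurableEmbedding_graph_coordinates he hgc
    rw [← hmp.integral_comp hme, Measure.volume_eq_prod, integral_prod_symm]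
    · simp only [graphDepth_coe_add_smul he, hyperProj_coe_add_smul he, integral_const_mul]
      have h1 := Measure.integral_comp_mul_left (fun t => w (t / h) / h * q t) h
      rw [abs_of_pos (inv_pos.2 hh), smul_eq_mul, eq_comm, inv_mul_eq_iff_eq_mul₀ hh.ne'] at h1
      refine h1.trans ?_
      rw [← integral_const_mul]
      refine integral_congr_ae (Eventually.of_forall fun t => ?_)
      simp only [mul_div_cancel_left₀ _ hh.ne']
      field_simp
    · exact (hmp.integrable_comp_emb hme).2 hint
  rw [← hq0, ← integral_mul_const]
  refine Tendsto.congr' (f₁ := fun h => ∫ t, w t * q (h * t)) ?_ ?_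
  · filter_upwards [self_mem_nhdsWithin] with h hh using (hmain h hh).symm
  · refine tendsto_integral_filter_of_dominated_convergence
      (fun t => ‖w t‖ * ∫ u, (hyperProj e '' T).indicator (fun _ => M * (1 + K)) u) ?_ ?_ ?_ ?_
    · filter_upwards [self_mem_nhdsWithin] with h hh
      have hh' : (0 : ℝ) < h := hh
      have hc : ContinuousOn (fun t => w t * q (h * t)) (Ici 0) :=
        hw.continuousOn.mul (hqc.comp (by fun_prop) fun t ht => mul_nonneg hh'.le ht)
      have hs : (fun t => w t * q (h * t)) = (Ici 0).indicator fun t => w t * q (h * t) := by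
        symm
        refine indicator_eq_self.2 fun t ht => ?_
        by_contra hneg
        exact ht (by simp [hw0 t (not_le.1 hneg).le])
      rw [hs]
      exact (aestronglyMeasurable_indicator_iff measurableSet_Ici).2
        (hc.aestronglyMeasurable measurableSet_Ici)
    · filter_upwards [self_mem_nhdsWithin] with h hh
      have hh' : (0 : ℝ) < h := hh
      refine Eventually.of_forall fun t => ?_
      rw [norm_mul]
      rcases le_or_gt t 0 with ht | ht
      · simp [hw0 t ht]
      · exact mul_le_mul_of_nonneg_left (hqb _ (by positivity)) (norm_nonneg _)
    · exact ((hw.integrable_of_hasCompactSupport hwc).norm).mul_const _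
    · refine Eventually.of_forall fun t => ?_
      rcases le_or_gt t 0 with ht | ht
      · simp [hw0 t ht]
      · refine Tendsto.const_mul _ ?_
        refine (hqc 0 self_mem_Ici).tendsto.comp (tendsto_nhdsWithin_iff.2 ⟨?_, ?_⟩)
        · have : Continuous fun h : ℝ => h * t := by fun_prop
          simpa using this.continuousWithinAt.tendsto (x := (0 : ℝ)) (s := Ioi 0)
        · filter_upwards [self_mem_nhdsWithin] with h hh
          exact mul_nonneg (le_of_lt hh) ht.le

end BoundaryLayer

/-! ### The divergence theorem on Lipschitz domains. -/

section GaussGreen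

open Set Filter Metric Module
open scoped NNReal ENNReal RealInnerProductSpace

variable {n : ℕ}

/-- The field `A`, a vector field seen as a functional on covectors, has distributional divergence
`f` in `Ω`. -/
def HasWeakDivergence (Ω : Set (Vec n)) (A : Vec n → (Vec n →L[ℝ] ℝ) →L[ℝ] ℝ)
    (f : Vec n → ℝ) : Prop :=
  ∀ (ζ : Vec n → ℝ) (L : ℝ≥0), LipschitzWith L ζ → HasCompactSupport ζ → tsupport ζ ⊆ Ω →
    ∫ x in Ω, (A x (fderiv ℝ ζ x) + f x * ζ x) = 0

/-- The normal component of `A` on the boundary of `Ω`. -/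
noncomputable def normalFlux (Ω : Set (Vec n)) (A : Vec n → (Vec n →L[ℝ] ℝ) →L[ℝ] ℝ) (x : Vec n) : ℝ :=
  A x (innerSL ℝ (outerNormal Ω x))

/-- Matches the dimension in the area formula with that in `surfaceMeasure`. A unit vector exists
only if `n ≥ 1`, so the natural subtraction is not truncated. -/
theorem finrank_hyperplane {e : Vec n} (he : ‖e‖ = 1) : finrank ℝ (ℝ ∙ e)ᗮ = n - 1 := by
  have h1 := (ℝ ∙ e).finrank_add_finrank_orthogonal
  rw [finrank_span_singleton (by rintro rfl; simp at he), finrank_euclideanSpace_fin] at h1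
  omega

variable {Ω O : Set (Vec n)} {e : Vec n} {g : (ℝ ∙ e)ᗮ → ℝ} {K : ℝ≥0}
  {A : Vec n → (Vec n →L[ℝ] ℝ) →L[ℝ] ℝ} {f θ : Vec n → ℝ}

namespace IsGraphChart

/-- Inside `O`, the closure of `Ω` is the region of nonnegative depth; outside `O`, the product
vanishes locally. The localized field thus satisfies the global hypothesis of the layer lemmas. -/
theorem continuousOn_smul (h : IsGraphChart Ω O e g K) (hA : ContinuousOn A (closure Ω))
    (hθ : Continuous θ) (hs : tsupport θ ⊆ O) :
    ContinuousOn (fun x => θ x • A x) {x | 0 ≤ graphDepth g x} := by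
  intro x hx
  by_cases hxO : x ∈ O
  · have h1 : ContinuousWithinAt (fun x => θ x • A x) (closure Ω) x :=
      hθ.continuousWithinAt.smul (hA x ((h.mem_closure_iff hxO).2 hx))
    refine h1.mono_of_mem_nhdsWithin ?_
    filter_upwards [self_mem_nhdsWithin, mem_nhdsWithin_of_mem_nhds (h.isOpen.mem_nhds hxO)] with
      z hz hzO using (h.mem_closure_iff hzO).2 hz
  · have h1 : θ =ᶠ[𝓝 x] 0 := notMem_tsupport_iff_eventuallyEq.1 fun hx' => hxO (hs hx')
    have h2 : (fun x => θ x • A x) =ᶠ[𝓝 x] fun _ => 0 := by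
      filter_upwards [h1] with z hz
      simp [hz]
    exact (continuousAt_const.congr h2.symm).continuousWithinAt

/-- The area density turns the unit normal into `conormal g`; where the graph leaves the chart, both
sides vanish with `θ`. -/
theorem boundary_eq (h : IsGraphChart Ω O e g K) (hs : tsupport θ ⊆ O) {u : (ℝ ∙ e)ᗮ}
    (hg : DifferentiableAt ℝ g u) :
    Real.sqrt (1 + ‖fderiv ℝ g u‖ ^ 2) * (θ (graphMap g u) * normalFlux Ω A (graphMap g u)) =
      (θ (graphMap g u) • A (graphMap g u)) (conormal g u) := by
  by_cases hu : graphMap g u ∈ O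
  · rw [conormal, ← h.smul_innerSL_outerNormal hu hg, map_smul, normalFlux, smul_eq_mul]
    rfl
  · have h0 : θ (graphMap g u) = 0 := image_eq_zero_of_notMem_tsupport fun hh => hu (hs hh)
    simp [h0]

/-- The flux through a graph boundary, localized by `θ`. -/
theorem integrable_flux_and_integral (h : IsGraphChart Ω O e g K) (hΩ : IsOpen Ω)
    (hA : ContinuousOn A (closure Ω)) (hθ : Continuous θ) (hc : HasCompactSupport θ)
    (hs : tsupport θ ⊆ O) :
    Integrable (fun x => θ x * normalFlux Ω A x) (surfaceMeasure Ω) ∧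
      ∫ x, θ x * normalFlux Ω A x ∂(surfaceMeasure Ω) =
        ∫ u, (θ (graphMap g u) • A (graphMap g u)) (conormal g u) := by
  have hB := h.continuousOn_smul hA hθ hs
  have h0 : ∀ x ∉ tsupport θ, θ x • A x = 0 := fun x hx => by
    rw [image_eq_zero_of_notMem_tsupport hx, zero_smul]
  have hG := measurableEmbedding_graphMap h.norm_eq h.lipschitz
  have hae : (fun u => Real.sqrt (1 + ‖fderiv ℝ g u‖ ^ 2) *
      (θ (graphMap g u) * normalFlux Ω A (graphMap g u))) =ᵐ[volume]
      fun u => (θ (graphMap g u) • A (graphMap g u)) (conormal g u) := by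
    filter_upwards [h.lipschitz.ae_differentiableAt] with u hu using h.boundary_eq hs hu
  have hz : ∀ x, x ∉ O → θ x * normalFlux Ω A x = 0 := fun x hx => by
    rw [image_eq_zero_of_notMem_tsupport fun hh => hx (hs hh), zero_mul]
  have hi : IntegrableOn (fun x => θ x * normalFlux Ω A x) (range (graphMap g)) μHE[n - 1] := by
    rw [← finrank_hyperplane h.norm_eq, integrableOn_range_graphMap_iff h.norm_eq h.lipschitz]
    exact (integrable_graph h.norm_eq h.lipschitz hB hc.isCompact h0).congr hae.symm
  have hset := h.frontier_inter_eq hΩ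
  constructor
  · refine IntegrableOn.of_forall_sdiff_eq_zero (s := frontier Ω ∩ O) ?_
      isClosed_frontier.measurableSet fun x hx => hz x fun hxO => hx.2 ⟨hx.1, hxO⟩
    rw [hset]
    exact hi.mono_set inter_subset_left
  · rw [← integral_congr_ae hae, ← setIntegral_range_graphMap h.norm_eq h.lipschitz
      (fun x => θ x * normalFlux Ω A x),
      finrank_hyperplane h.norm_eq, surfaceMeasure,
      setIntegral_eq_of_subset_of_forall_sdiff_eq_zero (s := frontier Ω ∩ O)
        isClosed_frontier.measurableSet inter_subset_left
        fun x hx => hz x fun hxO => hx.2 ⟨hx.1, hxO⟩, hset]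
    exact (setIntegral_eq_of_subset_of_forall_sdiff_eq_zero hG.measurableSet_range
      inter_subset_left fun x hx => hz x fun hxO => hx.2 ⟨hx.1, hxO⟩).symm

end IsGraphChart

theorem integrableOn_of_continuousOn_closure (hΩ : IsOpen Ω) (hA : ContinuousOn A (closure Ω))
    (hf : ContinuousOn f (closure Ω)) (hθ : ContDiff ℝ 1 θ) (hc : HasCompactSupport θ) :
    IntegrableOn (fun x => A x (fderiv ℝ θ x) + f x * θ x) Ω := by
  have hcont : ContinuousOn (fun x => A x (fderiv ℝ θ x) + f x * θ x) (closure Ω) :=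
    (hA.clm_apply (hθ.continuous_fderiv one_ne_zero).continuousOn).add
      (hf.mul hθ.continuous.continuousOn)
  have hcpt : IsCompact (closure Ω ∩ tsupport θ) := hc.isCompact.inter_left isClosed_closure
  have h1 := (hcont.mono (inter_subset_left (t := tsupport θ))).integrableOn_compact
    (μ := volume) hcpt
  refine IntegrableOn.of_forall_sdiff_eq_zero (h1.mono_set
    (inter_subset_inter_left _ subset_closure)) hΩ.measurableSet fun x hx => ?_
  have hx' : x ∉ tsupport θ := fun hh => hx.2 ⟨hx.1, hh⟩
  rw [fderiv_of_notMem_tsupport ℝ hx', image_eq_zero_of_notMem_tsupport hx']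
  simp

/-- The divergence theorem localized in a graph chart. -/
theorem IsGraphChart.gaussGreen (h : IsGraphChart Ω O e g K) (hΩ : IsOpen Ω)
    (hA : ContinuousOn A (closure Ω)) (hf : ContinuousOn f (closure Ω))
    (hdiv : HasWeakDivergence Ω A f) (hθ : ContDiff ℝ 1 θ) (hc : HasCompactSupport θ)
    (hs : tsupport θ ⊆ O) :
    ∫ x in Ω, (A x (fderiv ℝ θ x) + f x * θ x) =
      ∫ u, (θ (graphMap g u) • A (graphMap g u)) (conormal g u) := by
  obtain ⟨η, L, hη, hηL, hη0, hη1, hz, ho, hdz, hdc, hint⟩ := exists_smooth_cutoff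
  have he := h.norm_eq
  have hB := h.continuousOn_smul hA hθ.continuous hs
  have hBz : ∀ x ∉ tsupport θ, θ x • A x = 0 := fun x hx => by
    rw [image_eq_zero_of_notMem_tsupport hx, zero_smul]
  have hdcont : Continuous (deriv η) := hη.continuous_deriv le_rfl
  have hdepth := continuous_graphDepth (e := e) h.lipschitz.continuous
  obtain ⟨Kθ, hKθ⟩ := hθ.lipschitzWith_of_hasCompactSupport hc one_ne_zero
  obtain ⟨Mθ, hMθ⟩ := hc.exists_bound_of_continuous hθ.continuous
  have hmemΩ : ∀ x, θ x ≠ 0 → 0 < graphDepth g x → x ∈ Ω := fun x hx hx' =>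
    (h.mem_iff x (hs (subset_tsupport _ hx))).2 hx'
  have hI := integrableOn_of_continuousOn_closure hΩ hA hf hθ hc
  let w : ℝ → Vec n → ℝ := fun t x => η (graphDepth g x / t)
  have hwc : ∀ t, Continuous (w t) := fun t => hη.continuous.comp (hdepth.div_const t)
  -- The weak divergence tested with `θ * w t`, expanded by the product rule. As the depth has
  -- gradient `-conormal`, the term with the derivative of the cutoff moves to the right with a
  -- positive sign.
  have hweak : ∀ t : ℝ, 0 < t →
      ∫ x in Ω, w t x * (A x (fderiv ℝ θ x) + f x * θ x) =
        ∫ x, deriv η (graphDepth g x / t) / t *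
          (θ x • A x) (conormal g (hyperProj e x)) := by
    intro t ht
    obtain ⟨C, hC⟩ := hdc.exists_bound_of_continuous hdcont
    have hJ : Integrable fun x => deriv η (graphDepth g x / t) / t *
        (θ x • A x) (conormal g (hyperProj e x)) := by
      refine integrable_layer (B := fun x => θ x • A x) (w := fun s => deriv η (s / t) / t)
        (C := C / t) he h.lipschitz hB hc.isCompact hBz
        ((hdcont.comp (continuous_id.div_const t)).div_const t) (fun s hs => ?_) fun s => ?_
      · rw [hdz _ (div_nonpos_of_nonpos_of_nonneg hs ht.le), zero_div]
      · rw [norm_div, Real.norm_of_nonneg ht.le]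
        gcongr
        exact hC _
    have hLw : LipschitzWith (L * (t⁻¹.toNNReal * (1 + K))) (w t) := by
      refine hηL.comp (LipschitzWith.of_dist_le_mul fun x y => ?_)
      have h1 := (lipschitzWith_graphDepth he h.lipschitz).dist_le_mul x y
      rw [Real.dist_eq] at h1 ⊢
      rw [← sub_div, abs_div, abs_of_pos ht, div_eq_inv_mul, NNReal.coe_mul, mul_assoc,
        Real.coe_toNNReal _ (by positivity)]
      exact mul_le_mul_of_nonneg_left h1 (by positivity)
    have hLip := hKθ.real_mul_of_bounded hLw (Mf := ⟨Mθ, (norm_nonneg _).trans (hMθ 0)⟩) (Mg := 1)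
      hMθ (fun x => by simpa [abs_of_nonneg (hη0 _), w] using hη1 _)
    have hsub : tsupport (fun x => θ x * w t x) ⊆ Ω := by
      have hcl : tsupport (fun x => θ x * w t x) ⊆ tsupport θ ∩ {x | t ≤ graphDepth g x} := by
        refine closure_minimal (fun x hx => ?_)
          ((isClosed_tsupport θ).inter (isClosed_le continuous_const hdepth))
        refine ⟨subset_tsupport _ (left_ne_zero_of_mul hx), ?_⟩
        by_contra hlt
        refine right_ne_zero_of_mul hx (hz _ ?_)
        rw [div_le_one ht]
        exact (not_le.1 hlt).le
      intro x hx
      have hx' := hcl hx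
      exact (h.mem_iff x (hs hx'.1)).2 (ht.trans_le hx'.2)
    have h1 := hdiv _ _ hLip hc.mul_right hsub
    have h2 : ∫ x in Ω, (A x (fderiv ℝ (fun x => θ x * w t x) x) + f x * (θ x * w t x)) =
        ∫ x in Ω, (w t x * (A x (fderiv ℝ θ x) + f x * θ x) -
          deriv η (graphDepth g x / t) / t * (θ x • A x) (conormal g (hyperProj e x))) := by
      refine integral_congr_ae (ae_restrict_of_ae ?_)
      filter_upwards [ae_differentiableAt_comp_hyperProj he h.lipschitz] with x hx
      have h3 : HasFDerivAt (w t) (deriv η (graphDepth g x / t) •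
          (t⁻¹ • -conormal g (hyperProj e x))) x := by
        have h4 : HasDerivAt η (deriv η (graphDepth g x / t)) (graphDepth g x / t) :=
          ((hη.differentiable one_ne_zero) _).hasDerivAt
        have h5 : HasFDerivAt (fun x => graphDepth g x / t)
            (t⁻¹ • -conormal g (hyperProj e x)) x := by
          have := (hasFDerivAt_graphDepth hx).const_mul t⁻¹
          simpa only [div_eq_inv_mul] using this
        exact h4.comp_hasFDerivAt x h5
      have h6 : fderiv ℝ (fun x => θ x * w t x) x = θ x • deriv η (graphDepth g x / t) • t⁻¹ •
          -conormal g (hyperProj e x) + w t x • fderiv ℝ θ x :=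
        (((hθ.differentiable one_ne_zero) x).hasFDerivAt.mul h3).fderiv
      rw [h6, map_add, map_smul, map_smul, map_smul, map_smul, map_neg,
        _root_.smul_apply]
      simp only [smul_eq_mul]
      ring
    rw [h2, integral_sub] at h1
    · rw [sub_eq_zero.1 h1]
      refine setIntegral_eq_integral_of_forall_compl_eq_zero fun x hx => ?_
      rcases le_or_gt (graphDepth g x) 0 with hd | hd
      · rw [hdz _ (div_nonpos_of_nonpos_of_nonneg hd ht.le), zero_div, zero_mul]
      · have : θ x = 0 := by_contra fun hne => hx (hmemΩ x hne hd)
        simp [this]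
    · refine hI.bdd_mul (hwc t).aestronglyMeasurable (c := 1) (Eventually.of_forall fun x => ?_)
      simpa [abs_of_nonneg (hη0 _), w] using hη1 _
    · exact hJ.integrableOn
  have hlim1 : Tendsto (fun t : ℝ => ∫ x in Ω, w t x * (A x (fderiv ℝ θ x) + f x * θ x))
      (𝓝[>] 0) (𝓝 (∫ x in Ω, (A x (fderiv ℝ θ x) + f x * θ x))) := by
    refine tendsto_integral_filter_of_dominated_convergence
      (fun x => ‖A x (fderiv ℝ θ x) + f x * θ x‖) ?_ ?_ hI.norm ?_
    · exact Eventually.of_forall fun t =>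
        (hwc t).aestronglyMeasurable.mul hI.aestronglyMeasurable
    · refine Eventually.of_forall fun t => Eventually.of_forall fun x => ?_
      rw [norm_mul]
      refine mul_le_of_le_one_left (norm_nonneg _) ?_
      simpa [abs_of_nonneg (hη0 _), w] using hη1 _
    · filter_upwards [ae_restrict_mem hΩ.measurableSet] with x hx
      by_cases hxθ : x ∈ tsupport θ
      · have hd : 0 < graphDepth g x := (h.mem_iff x (hs hxθ)).1 hx
        refine tendsto_const_nhds.congr' ?_
        filter_upwards [Ioc_mem_nhdsGT (half_pos hd)] with t ht
        have : w t x = 1 := ho _ (by rw [le_div_iff₀ ht.1]; linarith [ht.2])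
        rw [this, one_mul]
      · rw [fderiv_of_notMem_tsupport ℝ hxθ, image_eq_zero_of_notMem_tsupport hxθ]
        simp
  have hlim2 := tendsto_integral_layer (B := fun x => θ x • A x) he h.lipschitz hB hc.isCompact
    hBz hdcont hdz hdc
  rw [hint, one_mul] at hlim2
  refine tendsto_nhds_unique hlim1 (hlim2.congr' ?_)
  filter_upwards [self_mem_nhdsWithin] with t ht using (hweak t ht).symm

/-- The divergence theorem on a Lipschitz domain, for a field that is continuous up to the boundary
and has a distributional divergence that is continuous up to the boundary. -/
theorem IsLipschitzDomain.gaussGreen (hΩ : IsLipschitzDomain Ω)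
    (hA : ContinuousOn A (closure Ω)) (hf : ContinuousOn f (closure Ω))
    (hdiv : HasWeakDivergence Ω A f) :
    Integrable (normalFlux Ω A) (surfaceMeasure Ω) ∧
      ∫ x in Ω, f x = ∫ x, normalFlux Ω A x ∂(surfaceMeasure Ω) := by
  have hcpt : IsCompact (closure Ω) := hΩ.2.1.isCompact_closure
  have hloc : ∀ p ∈ closure Ω, ∃ O : Set (Vec n), IsOpen O ∧ p ∈ O ∧
      ∀ θ : Vec n → ℝ, ContDiff ℝ 1 θ → tsupport θ ⊆ O →
        Integrable (fun x => θ x * normalFlux Ω A x) (surfaceMeasure Ω) ∧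
        IntegrableOn (fun x => A x (fderiv ℝ θ x) + f x * θ x) Ω ∧
        ∫ x in Ω, (A x (fderiv ℝ θ x) + f x * θ x) =
          ∫ x, θ x * normalFlux Ω A x ∂(surfaceMeasure Ω) := by
    intro p hp
    by_cases hpΩ : p ∈ Ω
    -- For an interior point, `θ` vanishes on the frontier and the identity is the weak divergence
    -- itself.
    · refine ⟨Ω, hΩ.1, hpΩ, fun θ hθ hs => ?_⟩
      have hc : HasCompactSupport θ :=
        hcpt.of_isClosed_subset (isClosed_tsupport θ) (hs.trans subset_closure)
      obtain ⟨Kθ, hKθ⟩ := hθ.lipschitzWith_of_hasCompactSupport hc one_ne_zero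
      have hae : (fun x => θ x * normalFlux Ω A x) =ᵐ[surfaceMeasure Ω] fun _ => 0 := by
        filter_upwards [ae_restrict_mem isClosed_frontier.measurableSet] with x hx
        have hx' : x ∉ Ω := by
          rw [hΩ.1.frontier_eq] at hx
          exact hx.2
        rw [image_eq_zero_of_notMem_tsupport fun hh => hx' (hs hh), zero_mul]
      refine ⟨(integrable_zero _ _ _).congr hae.symm,
        integrableOn_of_continuousOn_closure hΩ.1 hA hf hθ hc, ?_⟩
      rw [integral_congr_ae hae, integral_zero]
      exact hdiv θ Kθ hKθ hc hs
    · have hpf : p ∈ frontier Ω := by rw [hΩ.1.frontier_eq]; exact ⟨hp, hpΩ⟩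
      obtain ⟨O, e, g, K, hpO, hO⟩ := hΩ.exists_isGraphChart hpf
      -- The ball serves only to force compact support.
      refine ⟨O ∩ ball p 1, hO.isOpen.inter isOpen_ball, ⟨hpO, mem_ball_self one_pos⟩,
        fun θ hθ hs => ?_⟩
      have hc : HasCompactSupport θ := (isCompact_closedBall p 1).of_isClosed_subset
        (isClosed_tsupport θ) (hs.trans (inter_subset_right.trans ball_subset_closedBall))
      have hs' := hs.trans inter_subset_left
      obtain ⟨h1, h2⟩ := hO.integrable_flux_and_integral hΩ.1 hA hθ.continuous hc hs'
      refine ⟨h1, integrableOn_of_continuousOn_closure hΩ.1 hA hf hθ hc, ?_⟩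
      rw [h2]
      exact hO.gaussGreen hΩ.1 hA hf hdiv hθ hc hs'
  choose! O hOo hOp hO using hloc
  obtain ⟨t, htΩ, htc⟩ := hcpt.elim_nhds_subcover O fun p hp => (hOo p hp).mem_nhds (hOp p hp)
  obtain ⟨ψ, hψ⟩ := SmoothPartitionOfUnity.exists_isSubordinate (modelWithCornersSelf ℝ (Vec n))
    (s := closure Ω) isClosed_closure (fun i : t => O i) (fun i => hOo i (htΩ i i.2))
    (fun x hx => by
      obtain ⟨p, hp, hxp⟩ := mem_iUnion₂.1 (htc hx)
      exact mem_iUnion.2 ⟨⟨p, hp⟩, hxp⟩)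
  have hψc : ∀ i, ContDiff ℝ 1 (ψ i) := fun i =>
    ((ψ i).contMDiff.contDiff).of_le (by exact_mod_cast le_top)
  have hsum : ∀ x ∈ closure Ω, ∑ i, ψ i x = 1 := fun x hx => by
    rw [← finsum_eq_sum_of_fintype]
    exact ψ.sum_eq_one hx
  have hψO := fun i : t => hO i (htΩ i i.2) (ψ i) (hψc i) (hψ i)
  have hflux : (fun x => ∑ i, ψ i x * normalFlux Ω A x) =ᵐ[surfaceMeasure Ω] normalFlux Ω A := by
    filter_upwards [ae_restrict_mem isClosed_frontier.measurableSet] with x hx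
    rw [← Finset.sum_mul, hsum x (frontier_subset_closure hx), one_mul]
  refine ⟨(integrable_finsetSum _ fun i _ => (hψO i).1).congr hflux, ?_⟩
  rw [← integral_congr_ae hflux, integral_finsetSum _ fun i _ => (hψO i).1,
    ← Finset.sum_congr rfl fun i _ => (hψO i).2.2, ← integral_finsetSum _ fun i _ => (hψO i).2.1]
  refine setIntegral_congr_fun hΩ.1.measurableSet fun x hx => ?_
  -- The partition of unity is constant in the open set `Ω`, so its gradients cancel and only `∫ f`
  -- survives.
  have hder : ∑ i, fderiv ℝ (ψ i) x = 0 := by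
    rw [← fderiv_fun_sum fun i _ => (hψc i).differentiable one_ne_zero x]
    have : (fun x => ∑ i, ψ i x) =ᶠ[𝓝 x] fun _ => 1 := by
      filter_upwards [hΩ.1.mem_nhds hx] with z hz using hsum z (subset_closure hz)
    rw [this.fderiv_eq]
    simp
  simp only [Finset.sum_add_distrib, ← map_sum, ← Finset.mul_sum, hder, map_zero, zero_add,
    hsum x (subset_closure hx), mul_one]

end GaussGreen

/-! ### Matrix tensors expressed through Fréchet derivatives. -/

section Tensors

variable {n m : ℕ}

theorem sum_gradMatrix_smul_elemMap (M : Vec n →L[ℝ] Vec m) :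
    ∑ i, ∑ α, gradMatrix M i α • elemMap i α = M := by
  refine ContinuousLinearMap.coe_injective
    ((EuclideanSpace.basisFun (Fin n) ℝ).toBasis.ext fun β => ?_)
  ext k
  simp [gradMatrix, elemMap, Pi.single_apply]

theorem frob_piola (G : Jet n m → ℝ) (j : Jet n m) (M : Vec n →L[ℝ] Vec m) :
    frob (piola G j) (gradMatrix M) = fderiv ℝ G j (0, 0, M) := by
  let ℓ : (Vec n →L[ℝ] Vec m) →L[ℝ] ℝ := (fderiv ℝ G j).comp
    ((ContinuousLinearMap.inr ℝ (Vec n) (Vec m × (Vec n →L[ℝ] Vec m))).comp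
      (ContinuousLinearMap.inr ℝ (Vec m) (Vec n →L[ℝ] Vec m)))
  have hℓ : ∀ N, ℓ N = fderiv ℝ G j (0, 0, N) := fun N => rfl
  rw [← hℓ, ← sum_gradMatrix_smul_elemMap M, map_sum, sum_gradMatrix_smul_elemMap, frob]
  refine Finset.sum_congr rfl fun i _ => ?_
  rw [map_sum]
  refine Finset.sum_congr rfl fun α _ => ?_
  rw [map_smul, smul_eq_mul, mul_comm]
  rfl

theorem gradMatrix_comp {l : ℕ} (F : Vec n →L[ℝ] Vec m) (B : Vec l →L[ℝ] Vec n) :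
    gradMatrix (F.comp B) = gradMatrix F * gradMatrix B := by
  ext i α
  have h : B (EuclideanSpace.single α 1) =
      ∑ β, B (EuclideanSpace.single α 1) β • EuclideanSpace.single β (1 : ℝ) := by
    ext k
    simp [Pi.single_apply]
  rw [Matrix.mul_apply]
  change F (B (EuclideanSpace.single α 1)) i = _
  rw [h, map_sum]
  simp [gradMatrix, mul_comm]

theorem frob_transpose_mul (F P : Matrix (Fin m) (Fin n) ℝ) (B : Matrix (Fin n) (Fin n) ℝ) :
    frob (Fᵀ * P) B = frob P (F * B) := by
  simp only [frob, Matrix.mul_apply, Matrix.transpose_apply, Finset.sum_mul, Finset.mul_sum]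
  have h1 : ∀ i : Fin n, ∑ α, ∑ j, F j i * P j α * B i α = ∑ j, ∑ α, F j i * P j α * B i α :=
    fun i => Finset.sum_comm
  simp only [h1]
  rw [Finset.sum_comm]
  refine Finset.sum_congr rfl fun j _ => ?_
  rw [Finset.sum_comm]
  exact Finset.sum_congr rfl fun α _ => Finset.sum_congr rfl fun i _ => by ring

theorem frob_sub (P Q M : Matrix (Fin m) (Fin n) ℝ) : frob (P - Q) M = frob P M - frob Q M := by
  simp only [frob, Matrix.sub_apply, sub_mul, Finset.sum_sub_distrib]

theorem frob_smul (c : ℝ) (P M : Matrix (Fin m) (Fin n) ℝ) : frob (c • P) M = c * frob P M := by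
  simp only [frob, Matrix.smul_apply, smul_eq_mul, mul_assoc, Finset.mul_sum]

theorem frob_sum {k : ℕ} (P : Fin k → Matrix (Fin m) (Fin n) ℝ) (M : Matrix (Fin m) (Fin n) ℝ) :
    frob (∑ i, P i) M = ∑ i, frob (P i) M := by
  simp only [frob, Matrix.sum_apply, Finset.sum_mul]
  have h : ∀ i, ∑ α, ∑ c, P c i α * M i α = ∑ c, ∑ α, P c i α * M i α := fun i => Finset.sum_comm
  simp only [h]
  exact Finset.sum_comm

/-- Moving `Fᵀ` across the Frobenius product turns `⟨Fᵀ P, B⟩` into `⟨P, F B⟩`, the derivative of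
`G` along `F B`. -/
theorem frob_eshelby (G : Jet n m → ℝ) (j : Jet n m) (B : Vec n →L[ℝ] Vec n) :
    frob (eshelby G j) (gradMatrix B) =
      G j * (gradMatrix B).trace - fderiv ℝ G j (0, 0, j.2.2.comp B) := by
  rw [eshelby, frob_sub, frob_smul, frob_transpose_mul, ← gradMatrix_comp, frob_piola]
  congr 2
  simp [frob, Matrix.one_apply, Matrix.trace]

/-- Writes boundary tractions as pairings with rank-one matrices, so that they are handled like the
first variations. -/
theorem mulVec_dotProduct_eq_frob (P : Matrix (Fin m) (Fin n) ℝ) (a : Vec n) (b : Vec m) :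
    (P *ᵥ ⇑a) ⬝ᵥ ⇑b = frob P (gradMatrix ((innerSL ℝ a).smulRight b)) := by
  simp only [frob, dotProduct, Matrix.mulVec, Finset.sum_mul]
  refine Finset.sum_congr rfl fun i _ => Finset.sum_congr rfl fun α _ => ?_
  simp [gradMatrix, mul_assoc, EuclideanSpace.inner_single_right]

theorem trace_gradMatrix_smulRight (B : Vec n →L[ℝ] ℝ) (x : Vec n) :
    (gradMatrix (B.smulRight x)).trace = B x := by
  have h : x = ∑ α, x α • EuclideanSpace.single α (1 : ℝ) := by
    ext k
    simp [Pi.single_apply]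
  conv_rhs => rw [h, map_sum]
  simp [gradMatrix, Matrix.trace, mul_comm]

theorem trace_gradMatrix_smul_id (c : ℝ) :
    (gradMatrix (c • ContinuousLinearMap.id ℝ (Vec n))).trace = c * n := by
  simp [gradMatrix, Matrix.trace, mul_comm]

theorem trace_gradMatrix_add (A B : Vec n →L[ℝ] Vec n) :
    (gradMatrix (A + B)).trace = (gradMatrix A).trace + (gradMatrix B).trace := by
  simp [gradMatrix, Matrix.trace, Finset.sum_add_distrib]

theorem continuous_trace_gradMatrix :
    Continuous fun A : Vec n →L[ℝ] Vec n => (gradMatrix A).trace := by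
  simp only [gradMatrix, Matrix.trace, Matrix.diag_apply, Matrix.of_apply]
  fun_prop

end Tensors

/-! ### The augmented Lagrangian and its scaling field. -/

section Lagrangian

open Set Filter

variable {n m k : ℕ}

/-- The derivative of the augmented Lagrangian `W - Λᵢ Cⁱ` along the configuration `y`. -/
noncomputable def lagrangianDeriv (W : Jet n m → ℝ) (C : Fin k → Jet n m → ℝ) (Ω : Set (Vec n))
    (y : Vec n → Vec m) (Λ : Fin k → Vec n → ℝ) (x : Vec n) : Jet n m →L[ℝ] ℝ :=
  fderiv ℝ W (jet Ω y x) - ∑ i, Λ i x • fderiv ℝ (C i) (jet Ω y x)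

/-- The augmented Lagrangian `W - Λᵢ Cⁱ` along the configuration `y`. -/
noncomputable def lagrangian (W : Jet n m → ℝ) (C : Fin k → Jet n m → ℝ) (Ω : Set (Vec n))
    (y : Vec n → Vec m) (Λ : Fin k → Vec n → ℝ) (x : Vec n) : ℝ :=
  W (jet Ω y x) - ∑ i, Λ i x * C i (jet Ω y x)

variable {U : Set (Jet n m)} {W : Jet n m → ℝ} {C : Fin k → Jet n m → ℝ} {Ω : Set (Vec n)}
  {y : Vec n → Vec m} {Λ : Fin k → Vec n → ℝ}

theorem lagrangianDeriv_apply (x : Vec n) (v : Jet n m) :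
    lagrangianDeriv W C Ω y Λ x v =
      fderiv ℝ W (jet Ω y x) v - ∑ i, Λ i x * fderiv ℝ (C i) (jet Ω y x) v := by
  simp [lagrangianDeriv]

theorem outerVar_sub_sum (φ : Vec n → Vec m) (x : Vec n) :
    outerVar Ω W y φ x - ∑ i, Λ i x * outerVar Ω (C i) y φ x =
      lagrangianDeriv W C Ω y Λ x (0, φ x, fderiv ℝ φ x) := by
  have h : ∀ G : Jet n m → ℝ, outerVar Ω G y φ x =
      fderiv ℝ G (jet Ω y x) (0, φ x, fderiv ℝ φ x) := by
    intro G
    rw [outerVar, frob_piola, ← map_add]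
    simp
  simp only [h, lagrangianDeriv_apply]

/-- Moving the points of the domain by `φ` changes `F` by `-F ∇φ` and the volume element by `tr ∇φ`.
-/
theorem innerVar_sub_sum (φ : Vec n → Vec n) (x : Vec n) :
    innerVar Ω W y φ x - ∑ i, Λ i x * innerVar Ω (C i) y φ x =
      lagrangianDeriv W C Ω y Λ x (φ x, 0, -(jet Ω y x).2.2.comp (fderiv ℝ φ x)) +
        lagrangian W C Ω y Λ x * (gradMatrix (fderiv ℝ φ x)).trace := by
  have h : ∀ G : Jet n m → ℝ, innerVar Ω G y φ x =
      fderiv ℝ G (jet Ω y x) (φ x, 0, -(jet Ω y x).2.2.comp (fderiv ℝ φ x)) +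
        G (jet Ω y x) * (gradMatrix (fderiv ℝ φ x)).trace := by
    intro G
    have h1 : ((φ x, 0, -(jet Ω y x).2.2.comp (fderiv ℝ φ x)) : Jet n m) =
        (φ x, 0, 0) - (0, 0, (jet Ω y x).2.2.comp (fderiv ℝ φ x)) := by simp
    rw [innerVar, frob_eshelby, h1, map_sub]
    ring
  simp only [h, lagrangianDeriv_apply, lagrangian, mul_add, Finset.sum_add_distrib, sub_mul,
    Finset.sum_mul, mul_assoc]
  ring

/-- The Noether field of the scaling symmetry, as a functional on covectors. -/
noncomputable def scalingField (W : Jet n m → ℝ) (C : Fin k → Jet n m → ℝ) (Ω : Set (Vec n))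
    (y : Vec n → Vec m) (Λ : Fin k → Vec n → ℝ) (x : Vec n) : (Vec n →L[ℝ] ℝ) →L[ℝ] ℝ :=
  (lagrangianDeriv W C Ω y Λ x).comp
    (((ContinuousLinearMap.inr ℝ (Vec n) (Vec m × (Vec n →L[ℝ] Vec m))).comp
      (ContinuousLinearMap.inr ℝ (Vec m) (Vec n →L[ℝ] Vec m))).comp
      ((ContinuousLinearMap.smulRightL ℝ (Vec n) (Vec m)).flip
        (y x - fderivWithin ℝ y (closure Ω) x x))) +
    lagrangian W C Ω y Λ x • ContinuousLinearMap.apply ℝ ℝ x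

theorem scalingField_apply (x : Vec n) (B : Vec n →L[ℝ] ℝ) :
    scalingField W C Ω y Λ x B =
      lagrangianDeriv W C Ω y Λ x (0, 0, B.smulRight (y x - fderivWithin ℝ y (closure Ω) x x)) +
        lagrangian W C Ω y Λ x * B x :=
  rfl

end Lagrangian

/-! ### First variations and the Noether identity. -/

section Noether

open Set Filter
open scoped NNReal

variable {n m k : ℕ}

theorem integrableOn_of_continuousOn_of_isCompact {Ω T : Set (Vec n)} (hΩ : IsOpen Ω)
    (hT : IsCompact T) (hTΩ : T ⊆ Ω) {F : Vec n → ℝ} (hF : ContinuousOn F Ω)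
    (h0 : ∀ x ∉ T, F x = 0) : IntegrableOn F Ω :=
  ((hF.mono hTΩ).integrableOn_compact (μ := volume) hT).of_forall_sdiff_eq_zero hΩ.measurableSet
    fun x hx => h0 x hx.2

theorem contDiff_of_contDiffOn_of_tsupport_subset {F : Type*} [NormedAddCommGroup F]
    [NormedSpace ℝ F] {Ω T : Set (Vec n)} (hΩ : IsOpen Ω) (hT : IsClosed T) (hTΩ : T ⊆ Ω)
    {φ : Vec n → F} (hφ : ContDiffOn ℝ 1 φ Ω) (h0 : ∀ x ∉ T, φ x = 0) : ContDiff ℝ 1 φ := by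
  refine contDiff_iff_contDiffAt.2 fun x => ?_
  by_cases hx : x ∈ T
  · exact hφ.contDiffAt (hΩ.mem_nhds (hTΩ hx))
  · refine contDiffAt_const (c := (0 : F)) |>.congr_of_eventuallyEq ?_
    filter_upwards [hT.isOpen_compl.mem_nhds hx] with z hz using h0 z hz

theorem integral_fderiv_apply_eq_zero {u : Vec n → ℝ} (hu : ContDiff ℝ 1 u)
    (hc : HasCompactSupport u) (v : Vec n) : ∫ x, fderiv ℝ u x v = 0 := by
  have h1 : Integrable fun x => fderiv ℝ u x v :=
    ((hu.continuous_fderiv one_ne_zero).clm_apply continuous_const).integrable_of_hasCompactSupport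
      (hc.fderiv_apply ℝ v)
  have h2 := integral_mul_fderiv_eq_neg_fderiv_mul_of_integrable (μ := volume)
    (f := fun _ : Vec n => (1 : ℝ)) (g := u) (v := v) (by simp) (by simpa using h1)
    (by simpa using hu.continuous.integrable_of_hasCompactSupport hc)
    (fun x _ => differentiableAt_const _) (fun x _ => hu.differentiable one_ne_zero x)
  simpa using h2

/-- The integrand is the divergence of `g ψ`. Extended by zero, each component is `C¹` with compact
support on the whole space, although `g` is controlled only in `Ω`. -/
theorem integral_divergence_eq_zero {Ω : Set (Vec n)} (hΩ : IsOpen Ω) {g : Vec n → ℝ}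
    (hg : ContDiffOn ℝ 1 g Ω) {ψ : Vec n → Vec n} (hψ : IsTestField Ω ψ) :
    ∫ x in Ω, (fderiv ℝ g x (ψ x) + g x * (gradMatrix (fderiv ℝ ψ x)).trace) = 0 := by
  obtain ⟨hψs, hψc, hψΩ⟩ := hψ
  have hψ1 : ContDiff ℝ 1 ψ := hψs.of_le (by exact_mod_cast le_top)
  let u : Fin n → Vec n → ℝ := fun α x => g x * ψ x α
  have hψα : ∀ α, ContDiff ℝ 1 fun x => ψ x α := fun α => contDiff_euclidean.1 hψ1 α
  have hu0 : ∀ α, ∀ x ∉ tsupport ψ, u α x = 0 := fun α x hx => by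
    simp [u, image_eq_zero_of_notMem_tsupport hx]
  have hu : ∀ α, ContDiff ℝ 1 (u α) := fun α =>
    contDiff_of_contDiffOn_of_tsupport_subset hΩ (isClosed_tsupport ψ) hψΩ
      (hg.mul (hψα α).contDiffOn) (hu0 α)
  have huc : ∀ α, HasCompactSupport (u α) := fun α => HasCompactSupport.intro hψc (hu0 α)
  have hd0 : ∀ α, ∀ x ∉ tsupport ψ, fderiv ℝ (u α) x = 0 := fun α x hx => by
    refine fderiv_of_notMem_tsupport ℝ fun hh => hx ?_
    refine closure_minimal ?_ (isClosed_tsupport ψ) hh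
    intro z hz
    by_contra hz'
    exact hz (hu0 α z hz')
  have hpt : ∀ x ∈ Ω, fderiv ℝ g x (ψ x) + g x * (gradMatrix (fderiv ℝ ψ x)).trace =
      ∑ α, fderiv ℝ (u α) x (EuclideanSpace.single α 1) := by
    intro x hx
    have h1 : ∀ α, fderiv ℝ (u α) x (EuclideanSpace.single α 1) =
        g x * fderiv ℝ ψ x (EuclideanSpace.single α 1) α +
          ψ x α * fderiv ℝ g x (EuclideanSpace.single α 1) := by
      intro α
      have h2 : HasFDerivAt g (fderiv ℝ g x) x :=
        ((hg.contDiffAt (hΩ.mem_nhds hx)).differentiableAt one_ne_zero).hasFDerivAt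
      have h3 : HasFDerivAt (fun x => ψ x α)
          ((EuclideanSpace.proj α : Vec n →L[ℝ] ℝ).comp (fderiv ℝ ψ x)) x :=
        (EuclideanSpace.proj α : Vec n →L[ℝ] ℝ).hasFDerivAt.comp x
          (hψ1.differentiable one_ne_zero x).hasFDerivAt
      have h4 := (h2.mul h3).fderiv
      have h5 : fderiv ℝ (u α) x = _ := h4
      rw [h5]
      simp
    have h6 : ψ x = ∑ α, ψ x α • EuclideanSpace.single α (1 : ℝ) := by
      ext k
      simp [Pi.single_apply]
    simp only [h1, Finset.sum_add_distrib]
    conv_lhs => rw [h6, map_sum]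
    simp only [map_smul, smul_eq_mul, Matrix.trace, Matrix.diag_apply, gradMatrix, Matrix.of_apply,
      Finset.mul_sum]
    ring
  rw [setIntegral_congr_fun hΩ.measurableSet hpt, setIntegral_eq_integral_of_forall_compl_eq_zero,
    integral_finsetSum]
  · exact Finset.sum_eq_zero fun α _ => integral_fderiv_apply_eq_zero (hu α) (huc α) _
  · intro α _
    exact (((hu α).continuous_fderiv one_ne_zero).clm_apply
      continuous_const).integrable_of_hasCompactSupport ((huc α).fderiv_apply ℝ _)
  · intro x hx
    exact Finset.sum_eq_zero fun α _ => by rw [hd0 α x fun hh => hx (hψΩ hh)]; rfl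

/-- Euler's identity for homogeneous functions of degree zero: differentiate `c ↦ G (c x, c y, F)`
at `c = 1`. Openness of `U` keeps the curve in `U` near `c = 1`. -/
theorem IsScaleFree.fderiv_eq_zero {U : Set (Jet n m)} (hU : IsOpen U) {G : Jet n m → ℝ}
    (hG : IsScaleFree U G) (hGd : ContDiffOn ℝ 1 G U) {x : Vec n} {y : Vec m}
    {F : Vec n →L[ℝ] Vec m} (hj : (x, y, F) ∈ U) : fderiv ℝ G (x, y, F) (x, y, 0) = 0 := by
  let γ : ℝ → Jet n m := fun c => (c • x, c • y, F)
  have hγ : HasDerivAt γ (x, y, 0) 1 := by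
    have h1 : HasDerivAt (fun c : ℝ => c • x) x 1 := by
      simpa using (hasDerivAt_id (1 : ℝ)).smul_const x
    have h2 : HasDerivAt (fun c : ℝ => c • y) y 1 := by
      simpa using (hasDerivAt_id (1 : ℝ)).smul_const y
    exact h1.prodMk (h2.prodMk (hasDerivAt_const _ _))
  have hγ1 : γ 1 = (x, y, F) := by simp [γ]
  have hd : HasFDerivAt G (fderiv ℝ G (γ 1)) (γ 1) := by
    rw [hγ1]
    exact ((hGd.contDiffAt (hU.mem_nhds hj)).differentiableAt one_ne_zero).hasFDerivAt
  have h3 := hd.comp_hasDerivAt 1 hγ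
  have h4 : G ∘ γ =ᶠ[𝓝 1] fun _ => G (x, y, F) := by
    have hcU : ∀ᶠ c in 𝓝 (1 : ℝ), γ c ∈ U :=
      hγ.continuousAt.eventually_mem (hU.mem_nhds (by rwa [hγ1]))
    filter_upwards [hcU, lt_mem_nhds one_pos] with c hc hc0 using hG c hc0 x y F hj hc
  have h5 := h3.unique ((hasDerivAt_const (1 : ℝ) (G (x, y, F))).congr_of_eventuallyEq h4)
  rwa [hγ1] at h5

variable {U : Set (Jet n m)} {W : Jet n m → ℝ} {C : Fin k → Jet n m → ℝ} {Ω : Set (Vec n)}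
  {y : Vec n → Vec m} {Λ : Fin k → Vec n → ℝ}

theorem jet_of_mem (hΩ : IsOpen Ω) {x : Vec n} (hx : x ∈ Ω) :
    jet Ω y x = (x, y x, fderiv ℝ y x) := by
  rw [jet, fderivWithin_of_mem_nhds (mem_of_superset (hΩ.mem_nhds hx) subset_closure)]

theorem IsAdmissible.continuousOn_jet (hΩ : IsLipschitzDomain Ω) (hy : IsAdmissible U C Ω y) :
    ContinuousOn (jet Ω y) (closure Ω) :=
  continuousOn_id.prodMk (hy.1.continuousOn.prodMk
    (hy.1.continuousOn_fderivWithin hΩ.uniqueDiffOn_closure le_rfl))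

theorem IsAdmissible.continuousOn_lagrangianDeriv (hΩ : IsLipschitzDomain Ω)
    (hy : IsAdmissible U C Ω y) (hU : IsOpen U) (hW : ContDiffOn ℝ 1 W U)
    (hC : ∀ i, ContDiffOn ℝ 1 (C i) U) (hΛ : ∀ i, ContinuousOn (Λ i) (closure Ω)) :
    ContinuousOn (lagrangianDeriv W C Ω y Λ) (closure Ω) := by
  have hj := hy.continuousOn_jet hΩ
  refine ((hW.continuousOn_fderiv_of_isOpen hU le_rfl).comp hj hy.2.1).sub ?_
  exact continuousOn_finsetSum _ fun i _ =>
    (hΛ i).smul (((hC i).continuousOn_fderiv_of_isOpen hU le_rfl).comp hj hy.2.1)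

theorem IsAdmissible.continuousOn_lagrangian (hΩ : IsLipschitzDomain Ω)
    (hy : IsAdmissible U C Ω y) (hW : ContDiffOn ℝ 1 W U)
    (hC : ∀ i, ContDiffOn ℝ 1 (C i) U) (hΛ : ∀ i, ContinuousOn (Λ i) (closure Ω)) :
    ContinuousOn (lagrangian W C Ω y Λ) (closure Ω) := by
  have hj := hy.continuousOn_jet hΩ
  refine (hW.continuousOn.comp hj hy.2.1).sub ?_
  exact continuousOn_finsetSum _ fun i _ => (hΛ i).mul ((hC i).continuousOn.comp hj hy.2.1)

theorem IsAdmissible.continuousOn_scalingField (hΩ : IsLipschitzDomain Ω)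
    (hy : IsAdmissible U C Ω y) (hU : IsOpen U) (hW : ContDiffOn ℝ 1 W U)
    (hC : ∀ i, ContDiffOn ℝ 1 (C i) U) (hΛ : ∀ i, ContinuousOn (Λ i) (closure Ω)) :
    ContinuousOn (scalingField W C Ω y Λ) (closure Ω) := by
  have h1 : ContinuousOn (fun x => y x - fderivWithin ℝ y (closure Ω) x x) (closure Ω) :=
    hy.1.continuousOn.sub ((hy.1.continuousOn_fderivWithin hΩ.uniqueDiffOn_closure le_rfl).clm_apply
      continuousOn_id)
  refine ((hy.continuousOn_lagrangianDeriv hΩ hU hW hC hΛ).clm_comp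
    (continuousOn_const.clm_comp ?_)).add
      ((hy.continuousOn_lagrangian hΩ hW hC hΛ).smul ?_)
  · exact (ContinuousLinearMap.continuous _).comp_continuousOn h1
  · exact (ContinuousLinearMap.continuous (ContinuousLinearMap.apply ℝ ℝ)).continuousOn

theorem IsAdmissible.lagrangian_eq (hy : IsAdmissible U C Ω y) {x : Vec n} (hx : x ∈ Ω) :
    lagrangian W C Ω y Λ x = W (jet Ω y x) := by
  simp [lagrangian, hy.2.2 x hx]

/-- The Euler-Lagrange equations can be tested with compactly supported fields of class `C¹`. -/
theorem SolvesEulerLagrange.of_contDiff (hE : SolvesEulerLagrange W C Ω y Λ) (hΩ : IsOpen Ω)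
    (hD : ContinuousOn (lagrangianDeriv W C Ω y Λ) Ω) {φ : Vec n → Vec m} (hφ : ContDiff ℝ 1 φ)
    (hc : HasCompactSupport φ) (hs : tsupport φ ⊆ Ω) :
    ∫ x in Ω, lagrangianDeriv W C Ω y Λ x (0, φ x, fderiv ℝ φ x) = 0 := by
  obtain ⟨L, hL⟩ := hφ.lipschitzWith_of_hasCompactSupport hc one_ne_zero
  let ι₂ : Vec m →L[ℝ] Jet n m := (ContinuousLinearMap.inr ℝ (Vec n)
    (Vec m × (Vec n →L[ℝ] Vec m))).comp (ContinuousLinearMap.inl ℝ (Vec m) (Vec n →L[ℝ] Vec m))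
  let ι₃ : (Vec n →L[ℝ] Vec m) →L[ℝ] Jet n m := (ContinuousLinearMap.inr ℝ (Vec n)
    (Vec m × (Vec n →L[ℝ] Vec m))).comp (ContinuousLinearMap.inr ℝ (Vec m) (Vec n →L[ℝ] Vec m))
  have hsplit : ∀ (ψ : Vec n → Vec m) (x : Vec n),
      (lagrangianDeriv W C Ω y Λ x).comp ι₃ (fderiv ℝ ψ x) +
        (lagrangianDeriv W C Ω y Λ x).comp ι₂ (ψ x) =
      lagrangianDeriv W C Ω y Λ x (0, ψ x, fderiv ℝ ψ x) := by
    intro ψ x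
    change lagrangianDeriv W C Ω y Λ x (ι₃ (fderiv ℝ ψ x)) +
      lagrangianDeriv W C Ω y Λ x (ι₂ (ψ x)) = _
    rw [← map_add]
    simp [ι₂, ι₃]
  have h := setIntegral_eq_zero_of_lipschitz_of_smooth hΩ
    (A := fun x => (lagrangianDeriv W C Ω y Λ x).comp ι₃)
    (b := fun x => (lagrangianDeriv W C Ω y Λ x).comp ι₂)
    (hD.clm_comp continuousOn_const) (hD.clm_comp continuousOn_const) (fun ψ h1 h2 h3 => by
      have h4 := hE ψ ⟨h1, h2, h3⟩
      simp only [outerVar_sub_sum] at h4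
      simpa only [hsplit] using h4) hL hc hs
  simpa only [hsplit] using h

/-- For configurations of class `C²`, the Euler-Lagrange equations imply the stationarity
equations. -/
theorem SolvesEulerLagrange.solvesStationarity (hE : SolvesEulerLagrange W C Ω y Λ)
    (hΩ : IsOpen Ω) (hU : IsOpen U) (hW : ContDiffOn ℝ 1 W U)
    (hC : ∀ i, ContDiffOn ℝ 1 (C i) U) (hy : IsAdmissible U C Ω y)
    (hD : ContinuousOn (lagrangianDeriv W C Ω y Λ) Ω) (hy2 : ContDiffOn ℝ 2 y Ω) :
    SolvesStationarity W C Ω y Λ := by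
  intro ψ hψ
  obtain ⟨hψs, hψc, hψΩ⟩ := id hψ
  have hψ1 : ContDiff ℝ 1 ψ := hψs.of_le (by exact_mod_cast le_top)
  have hF : ContDiffOn ℝ 1 (fderiv ℝ y) Ω := hy2.fderiv_of_isOpen hΩ (by norm_num)
  -- Moving the points by `ψ` corresponds, up to a total divergence, to the outer variation `-∇y ψ`.
  -- It is only `C¹`, hence the use of `SolvesEulerLagrange.of_contDiff`.
  let φ : Vec n → Vec m := fun x => fderiv ℝ y x (ψ x)
  have hφ0 : ∀ x ∉ tsupport ψ, φ x = 0 := fun x hx => by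
    simp [φ, image_eq_zero_of_notMem_tsupport hx]
  have hφΩ : ContDiffOn ℝ 1 φ Ω := hF.clm_apply hψ1.contDiffOn
  have hφ : ContDiff ℝ 1 φ :=
    contDiff_of_contDiffOn_of_tsupport_subset hΩ (isClosed_tsupport ψ) hψΩ hφΩ hφ0
  have hφs : tsupport φ ⊆ tsupport ψ :=
    closure_minimal (fun z hz => by_contra fun hz' => hz (hφ0 z hz')) (isClosed_tsupport ψ)
  have hEL := hE.of_contDiff hΩ hD hφ (HasCompactSupport.intro hψc hφ0) (hφs.trans hψΩ)
  have hjet : ∀ x ∈ Ω, jet Ω y =ᶠ[𝓝 x] fun z => (z, y z, fderiv ℝ y z) := fun x hx => by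
    filter_upwards [hΩ.mem_nhds hx] with z hz using jet_of_mem hΩ hz
  have hjetd : ContDiffOn ℝ 1 (jet Ω y) Ω := by
    refine ContDiffOn.congr (f := fun z => (z, y z, fderiv ℝ y z)) ?_ fun z hz => jet_of_mem hΩ hz
    exact contDiffOn_id.prodMk ((hy2.of_le (by norm_num)).prodMk hF)
  have hUΩ : MapsTo (jet Ω y) Ω U := fun x hx => hy.2.1 x (subset_closure hx)
  have hdiv := integral_divergence_eq_zero hΩ (hW.comp hjetd hUΩ) hψ
  have hjd : ∀ x ∈ Ω, fderiv ℝ (jet Ω y) x (ψ x) =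
      (ψ x, φ x, fderiv ℝ (fderiv ℝ y) x (ψ x)) := by
    intro x hx
    have h1 : HasFDerivAt y (fderiv ℝ y x) x :=
      ((hy2.contDiffAt (hΩ.mem_nhds hx)).differentiableAt two_ne_zero).hasFDerivAt
    have h2 : HasFDerivAt (fderiv ℝ y) (fderiv ℝ (fderiv ℝ y) x) x :=
      ((hF.contDiffAt (hΩ.mem_nhds hx)).differentiableAt one_ne_zero).hasFDerivAt
    have h3 : HasFDerivAt (fun z => (z, y z, fderiv ℝ y z)) ((ContinuousLinearMap.id ℝ (Vec n)).prod
        ((fderiv ℝ y x).prod (fderiv ℝ (fderiv ℝ y) x))) x :=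
      (hasFDerivAt_id x).prodMk (h1.prodMk h2)
    rw [(hjet x hx).fderiv_eq, h3.fderiv]
    rfl
  have hcomp : ∀ (G : Jet n m → ℝ), ContDiffOn ℝ 1 G U → ∀ x ∈ Ω,
      fderiv ℝ (G ∘ jet Ω y) x (ψ x) =
        fderiv ℝ G (jet Ω y x) (ψ x, φ x, fderiv ℝ (fderiv ℝ y) x (ψ x)) := by
    intro G hG x hx
    rw [fderiv_comp x
      ((hG.contDiffAt (hU.mem_nhds (hUΩ hx))).differentiableAt one_ne_zero)
      ((hjetd.contDiffAt (hΩ.mem_nhds hx)).differentiableAt one_ne_zero),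
      ContinuousLinearMap.comp_apply, hjd x hx]
  -- The constraints vanish identically in `Ω`, so their derivatives along `y` vanish too. The
  -- multipliers `Λᵢ`, which are merely continuous, never have to be differentiated.
  have hconstr : ∀ i, ∀ x ∈ Ω,
      fderiv ℝ (C i) (jet Ω y x) (ψ x, φ x, fderiv ℝ (fderiv ℝ y) x (ψ x)) = 0 := by
    intro i x hx
    rw [← hcomp _ (hC i) x hx]
    have : C i ∘ jet Ω y =ᶠ[𝓝 x] fun _ => 0 := by
      filter_upwards [hΩ.mem_nhds hx] with z hz using hy.2.2 z hz i
    rw [this.fderiv_eq]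
    simp
  have hφd : ∀ x ∈ Ω, fderiv ℝ φ x =
      fderiv ℝ (fderiv ℝ y) x (ψ x) + (fderiv ℝ y x).comp (fderiv ℝ ψ x) := by
    intro x hx
    have h2 : HasFDerivAt (fderiv ℝ y) (fderiv ℝ (fderiv ℝ y) x) x :=
      ((hF.contDiffAt (hΩ.mem_nhds hx)).differentiableAt one_ne_zero).hasFDerivAt
    have h3 := (h2.clm_apply (hψ1.differentiable one_ne_zero x).hasFDerivAt).fderiv
    have h4 : fderiv ℝ φ x = _ := h3
    -- The gradient of `φ` contains `D²y(v, ψ)`, the chain rule for the jet `D²y(ψ, v)`.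
    have hsymm := (hy2.contDiffAt (hΩ.mem_nhds hx)).isSymmSndFDerivAt
      (by rw [minSmoothness_of_isRCLikeNormedField])
    rw [h4]
    ext1 v
    have h5 : fderiv ℝ (fderiv ℝ y) x v (ψ x) = fderiv ℝ (fderiv ℝ y) x (ψ x) v := hsymm v (ψ x)
    simp [h5, add_comm]
  -- The inner variation is the divergence of `W ψ` minus the outer variation along `φ`; both
  -- integrate to zero.
  have hpt : ∀ x ∈ Ω, innerVar Ω W y ψ x - ∑ i, Λ i x * innerVar Ω (C i) y ψ x =
      (fderiv ℝ (W ∘ jet Ω y) x (ψ x) + (W ∘ jet Ω y) x * (gradMatrix (fderiv ℝ ψ x)).trace) -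
        lagrangianDeriv W C Ω y Λ x (0, φ x, fderiv ℝ φ x) := by
    intro x hx
    have h1 : ((ψ x, 0, -(jet Ω y x).2.2.comp (fderiv ℝ ψ x)) : Jet n m) =
        (ψ x, φ x, fderiv ℝ (fderiv ℝ y) x (ψ x)) - (0, φ x, fderiv ℝ φ x) := by
      rw [hφd x hx, jet_of_mem hΩ hx]
      simp
    have h2 : lagrangianDeriv W C Ω y Λ x (ψ x, φ x, fderiv ℝ (fderiv ℝ y) x (ψ x)) =
        fderiv ℝ (W ∘ jet Ω y) x (ψ x) := by
      rw [lagrangianDeriv_apply, hcomp W hW x hx]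
      simp [hconstr _ x hx]
    rw [innerVar_sub_sum, h1, map_sub, h2, hy.lagrangian_eq hx, Function.comp_apply]
    ring
  rw [setIntegral_congr_fun hΩ.measurableSet hpt, integral_sub, hdiv, hEL, sub_zero]
  · have hWj : ContDiffOn ℝ 1 (W ∘ jet Ω y) Ω := hW.comp hjetd hUΩ
    refine integrableOn_of_continuousOn_of_isCompact hΩ hψc hψΩ ?_ fun x hx => ?_
    · exact ((hWj.continuousOn_fderiv_of_isOpen hΩ le_rfl).clm_apply
        hψ1.continuous.continuousOn).add (hWj.continuousOn.mul
          (continuous_trace_gradMatrix.comp (hψ1.continuous_fderiv one_ne_zero)).continuousOn)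
    · rw [image_eq_zero_of_notMem_tsupport hx, fderiv_of_notMem_tsupport ℝ hx]
      simp [gradMatrix, Matrix.trace]
  · refine integrableOn_of_continuousOn_of_isCompact hΩ hψc hψΩ ?_ fun x hx => ?_
    · exact hD.clm_apply (continuousOn_const.prodMk (hφ.continuous.continuousOn.prodMk
        (hφ.continuous_fderiv one_ne_zero).continuousOn))
    · rw [hφ0 x hx, fderiv_of_notMem_tsupport ℝ fun hh => hx (hφs hh)]
      exact map_zero (lagrangianDeriv W C Ω y Λ x)

/-- Noether's conservation law for the scaling symmetry. -/
theorem hasWeakDivergence_scalingField (hΩ : IsLipschitzDomain Ω) (hU : IsOpen U)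
    (hW : ContDiffOn ℝ 1 W U) (hC : ∀ i, ContDiffOn ℝ 1 (C i) U) (hWs : IsScaleFree U W)
    (hCs : ∀ i, IsScaleFree U (C i)) (hy : IsAdmissible U C Ω y)
    (hΛ : IsLagrangeMultiplier W C Ω y Λ) :
    HasWeakDivergence Ω (scalingField W C Ω y Λ) fun x => (n : ℝ) * W (jet Ω y x) := by
  have hΩo := hΩ.1
  have hDc := hy.continuousOn_lagrangianDeriv hΩ hU hW hC hΛ.1
  have hD := hDc.mono subset_closure
  have hLc := (hy.continuousOn_lagrangian hΩ hW hC hΛ.1).mono subset_closure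
  have hstat : SolvesStationarity W C Ω y Λ := hΛ.2.2.elim
    (fun h2 => hΛ.2.1.solvesStationarity hΩo hU hW hC hy hD h2) id
  have hWj : ContinuousOn (fun x => W (jet Ω y x)) Ω :=
    (hW.continuousOn.comp (hy.continuousOn_jet hΩ) hy.2.1).mono subset_closure
  have hyΩ : ContDiffOn ℝ 1 y Ω := hy.1.mono subset_closure
  intro ζ L hζ hc hs
  refine setIntegral_eq_zero_of_lipschitz_of_smooth hΩo
    (A := scalingField W C Ω y Λ)
    (b := fun x => ((n : ℝ) * W (jet Ω y x)) • ContinuousLinearMap.id ℝ ℝ)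
    ((hy.continuousOn_scalingField hΩ hU hW hC hΛ.1).mono subset_closure)
    ((continuousOn_const.mul hWj).smul continuousOn_const) ?_ hζ hc hs
  intro θ hθ hθc hθs
  have hθ1 : ContDiff ℝ 1 θ := hθ.of_le (by exact_mod_cast le_top)
  -- The fields `θ y` and `θ x` are the infinitesimal scaling, localized by `θ`.
  let φ : Vec n → Vec m := fun x => θ x • y x
  have hφ0 : ∀ x ∉ tsupport θ, φ x = 0 := fun x hx => by
    simp [φ, image_eq_zero_of_notMem_tsupport hx]
  have hφ : ContDiff ℝ 1 φ := contDiff_of_contDiffOn_of_tsupport_subset hΩo (isClosed_tsupport θ)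
    hθs (hθ1.contDiffOn.smul hyΩ) hφ0
  have hφs : tsupport φ ⊆ tsupport θ :=
    closure_minimal (fun z hz => by_contra fun hz' => hz (hφ0 z hz')) (isClosed_tsupport θ)
  have hEL := hΛ.2.1.of_contDiff hΩo hD hφ (HasCompactSupport.intro hθc hφ0) (hφs.trans hθs)
  let χ : Vec n → Vec n := fun x => θ x • x
  have hχ0 : ∀ x ∉ tsupport θ, χ x = 0 := fun x hx => by
    simp [χ, image_eq_zero_of_notMem_tsupport hx]
  have hχ : ContDiff ℝ ∞ χ := hθ.smul contDiff_id
  have hχ1 : ContDiff ℝ 1 χ := hχ.of_le (by exact_mod_cast le_top)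
  have hχs : tsupport χ ⊆ tsupport θ :=
    closure_minimal (fun z hz => by_contra fun hz' => hz (hχ0 z hz')) (isClosed_tsupport θ)
  have hst := hstat χ ⟨hχ, HasCompactSupport.intro hθc hχ0, hχs.trans hθs⟩
  simp only [innerVar_sub_sum] at hst
  have hpt : ∀ x ∈ Ω, scalingField W C Ω y Λ x (fderiv ℝ θ x) +
      (((n : ℝ) * W (jet Ω y x)) • ContinuousLinearMap.id ℝ ℝ) (θ x) =
      lagrangianDeriv W C Ω y Λ x (0, φ x, fderiv ℝ φ x) +
      (lagrangianDeriv W C Ω y Λ x (χ x, 0, -(jet Ω y x).2.2.comp (fderiv ℝ χ x)) +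
        lagrangian W C Ω y Λ x * (gradMatrix (fderiv ℝ χ x)).trace) := by
    intro x hx
    have hθd : HasFDerivAt θ (fderiv ℝ θ x) x := (hθ1.differentiable one_ne_zero x).hasFDerivAt
    have hyd : HasFDerivAt y (fderiv ℝ y x) x :=
      ((hyΩ.contDiffAt (hΩo.mem_nhds hx)).differentiableAt one_ne_zero).hasFDerivAt
    have h1 : fderiv ℝ φ x = θ x • fderiv ℝ y x + (fderiv ℝ θ x).smulRight (y x) :=
      (hθd.smul hyd).fderiv
    have h2 : fderiv ℝ χ x = θ x • ContinuousLinearMap.id ℝ (Vec n) +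
        (fderiv ℝ θ x).smulRight x := (hθd.smul (hasFDerivAt_id x)).fderiv
    have hj := jet_of_mem (y := y) hΩo hx
    have hjU : (x, y x, fderiv ℝ y x) ∈ U := hj ▸ hy.2.1 x (subset_closure hx)
    have hscale : lagrangianDeriv W C Ω y Λ x (x, y x, 0) = 0 := by
      rw [lagrangianDeriv_apply, hj, hWs.fderiv_eq_zero hU hW hjU]
      simp [(hCs _).fderiv_eq_zero hU (hC _) hjU]
    have hF : fderivWithin ℝ y (closure Ω) x = fderiv ℝ y x :=
      fderivWithin_of_mem_nhds (mem_of_superset (hΩo.mem_nhds hx) subset_closure)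
    -- In the sum, the `θ F` parts of `∇(θ y)` and `F ∇(θ x)` cancel. What is left is `θ` times the
    -- scaling direction, annihilated by `hscale`, and a rank-one term in `∇θ`.
    have h3 : ((0, φ x, fderiv ℝ φ x) : Jet n m) +
        (χ x, 0, -(jet Ω y x).2.2.comp (fderiv ℝ χ x)) =
        θ x • (x, y x, 0) + (0, 0, (fderiv ℝ θ x).smulRight (y x - fderiv ℝ y x x)) := by
      rw [h1, h2, hj]
      refine Prod.ext (by simp [χ]) (Prod.ext (by simp [φ]) ?_)
      ext1 v
      simp [smul_sub]
      abel
    rw [← add_assoc, ← map_add, h3, map_add, map_smul, hscale, scalingField_apply, hF, h2,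
      trace_gradMatrix_add, trace_gradMatrix_smul_id, trace_gradMatrix_smulRight,
      hy.lagrangian_eq hx]
    simp
    ring
  rw [setIntegral_congr_fun hΩo.measurableSet hpt, integral_add, hEL, hst, add_zero]
  · refine integrableOn_of_continuousOn_of_isCompact hΩo hθc hθs ?_ fun x hx => ?_
    · exact hD.clm_apply (continuousOn_const.prodMk (hφ.continuous.continuousOn.prodMk
        (hφ.continuous_fderiv one_ne_zero).continuousOn))
    · rw [hφ0 x hx, fderiv_of_notMem_tsupport ℝ fun hh => hx (hφs hh)]
      exact map_zero (lagrangianDeriv W C Ω y Λ x)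
  · refine integrableOn_of_continuousOn_of_isCompact hΩo hθc hθs ?_ fun x hx => ?_
    · have hjc := (hy.continuousOn_jet hΩ).mono subset_closure
      have hFc : ContinuousOn (fun x => (jet Ω y x).2.2) Ω :=
        continuous_snd.comp_continuousOn (continuous_snd.comp_continuousOn hjc)
      refine (hD.clm_apply (hχ1.continuous.continuousOn.prodMk (continuousOn_const.prodMk
        (hFc.clm_comp (hχ1.continuous_fderiv one_ne_zero).continuousOn).neg))).add (hLc.mul
          (continuous_trace_gradMatrix.comp (hχ1.continuous_fderiv one_ne_zero)).continuousOn)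
    · rw [hχ0 x hx, fderiv_of_notMem_tsupport ℝ fun hh => hx (hχs hh)]
      have h1 : ((0, 0, -(jet Ω y x).2.2.comp (0 : Vec n →L[ℝ] Vec n)) : Jet n m) = 0 := by simp
      rw [h1, map_zero]
      simp [gradMatrix, Matrix.trace]

end Noether

/-! ### The boundary formula and the incompressible case. -/

section EnergyFormula

open Set Filter

variable {n m k : ℕ}

/-- Since `Fᵀ P n · x = P n · F x`, the two tractions combine into `P n · (y - F x)` plus `L n · x`.
-/
theorem boundaryWork_eq_normalFlux (W : Jet n m → ℝ) (C : Fin k → Jet n m → ℝ) (Ω : Set (Vec n))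
    (y : Vec n → Vec m) (Λ : Fin k → Vec n → ℝ) :
    boundaryWork W C Ω y Λ = normalFlux Ω (scalingField W C Ω y Λ) := by
  funext x
  set B : Vec n →L[ℝ] ℝ := innerSL ℝ (outerNormal Ω x) with hB
  have h1 : ((0, 0, B.smulRight (y x - fderivWithin ℝ y (closure Ω) x x)) : Jet n m) =
      (0, 0, B.smulRight (y x)) - (0, 0, (jet Ω y x).2.2.comp (B.smulRight x)) := by
    refine Prod.ext (by simp) (Prod.ext (by simp) ?_)
    ext1 v
    simp [jet, smul_sub]
  rw [boundaryWork, normalFlux, mulVec_dotProduct_eq_frob, mulVec_dotProduct_eq_frob, ← hB,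
    scalingField_apply, h1, map_sub]
  simp only [frob_sub, frob_sum, frob_smul, frob_piola, frob_eshelby, trace_gradMatrix_smulRight,
    lagrangianDeriv_apply, lagrangian, sub_mul, Finset.sum_mul, mul_sub, Finset.sum_sub_distrib,
    mul_assoc]
  ring

/-- The energy of a stationary extremal is determined by the work on the boundary. -/
theorem integral_eq_integral_boundaryWork {Ω : Set (Vec n)} (hΩ : IsLipschitzDomain Ω)
    {U : Set (Jet n m)} {W : Jet n m → ℝ} {C : Fin k → Jet n m → ℝ} {y : Vec n → Vec m}
    {Λ : Fin k → Vec n → ℝ} (hU : IsOpen U) (hW : ContDiffOn ℝ 1 W U)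
    (hC : ∀ i, ContDiffOn ℝ 1 (C i) U) (hWs : IsScaleFree U W) (hCs : ∀ i, IsScaleFree U (C i))
    (hy : IsAdmissible U C Ω y) (hΛ : IsLagrangeMultiplier W C Ω y Λ) :
    IntegrableOn (fun x => W (jet Ω y x)) Ω ∧
      Integrable (boundaryWork W C Ω y Λ) (surfaceMeasure Ω) ∧
      ∫ x in Ω, (n : ℝ) * W (jet Ω y x) = ∫ x, boundaryWork W C Ω y Λ x ∂(surfaceMeasure Ω) := by
  have hWj : ContinuousOn (fun x => W (jet Ω y x)) (closure Ω) :=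
    hW.continuousOn.comp (hy.continuousOn_jet hΩ) hy.2.1
  rw [boundaryWork_eq_normalFlux]
  exact ⟨(hWj.integrableOn_compact hΩ.2.1.isCompact_closure).mono_set subset_closure,
    hΩ.gaussGreen (hy.continuousOn_scalingField hΩ hU hW hC hΛ.1) (continuousOn_const.mul hWj)
      (hasWeakDivergence_scalingField hΩ hU hW hC hWs hCs hy hΛ)⟩

theorem contDiff_incompressibility (i : Fin 1) :
    ContDiff ℝ 1 (incompressibility i : Jet n n → ℝ) := by
  have hentry : ∀ a b : Fin n, ContDiff ℝ 1 fun j : Jet n n => gradMatrix j.2.2 a b := by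
    intro a b
    have h1 : ContDiff ℝ 1 fun j : Jet n n => j.2.2 (EuclideanSpace.single b 1) :=
      (contDiff_snd.comp contDiff_snd).clm_apply contDiff_const
    exact contDiff_euclidean.1 h1 a
  change ContDiff ℝ 1 fun j : Jet n n => (gradMatrix j.2.2).det - 1
  simp only [Matrix.det_apply]
  exact (ContDiff.sum fun σ _ => (contDiff_prod fun a _ => hentry _ _).const_smul _).sub
    contDiff_const

/-- Only row `i` changes, and the determinant is linear in that row with the cofactors as
coefficients. -/
theorem det_add_smul_gradMatrix_elemMap (A : Matrix (Fin n) (Fin n) ℝ) (i α : Fin n) (t : ℝ) :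
    (A + t • gradMatrix (elemMap i α)).det = A.det + t * cof A i α := by
  have h1 : A + t • gradMatrix (elemMap i α) =
      A.updateRow i (A i + t • (Pi.single α (1 : ℝ) : Fin n → ℝ)) := by
    ext a b
    by_cases ha : a = i
    · subst ha
      by_cases hb : b = α
      · subst hb
        simp [gradMatrix, elemMap]
      · simp [gradMatrix, elemMap, hb, Ne.symm hb]
    · by_cases hb : b = α
      · subst hb
        simp [gradMatrix, elemMap, ha]
      · simp [gradMatrix, elemMap, Ne.symm hb, ha]
  rw [h1, Matrix.det_updateRow_add, Matrix.det_updateRow_smul, Matrix.updateRow_eq_self, cof,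
    Matrix.transpose_apply, Matrix.adjugate_apply]

theorem piola_incompressibility (i : Fin 1) (j : Jet n n) :
    piola (incompressibility i) j = cof (gradMatrix j.2.2) := by
  ext a α
  have hd : HasFDerivAt (incompressibility i) (fderiv ℝ (incompressibility i) j) j :=
    ((contDiff_incompressibility i).differentiable one_ne_zero j).hasFDerivAt
  have h1 := hd.hasLineDerivAt (0, 0, elemMap a α)
  have h2 : (fun t : ℝ => incompressibility i (j + t • ((0, 0, elemMap a α) : Jet n n))) =
      fun t => (gradMatrix j.2.2).det + t * cof (gradMatrix j.2.2) a α - 1 := by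
    funext t
    rw [← det_add_smul_gradMatrix_elemMap]
    rfl
  rw [HasLineDerivAt, h2] at h1
  have h3 : HasDerivAt (fun t : ℝ => (gradMatrix j.2.2).det + t * cof (gradMatrix j.2.2) a α - 1)
      (cof (gradMatrix j.2.2) a α) 0 := by
    simpa using (((hasDerivAt_id (0 : ℝ)).mul_const _).const_add (gradMatrix j.2.2).det).sub_const 1
  exact h1.unique h3

/-- As `Fᵀ cof F = (det F) I`, the determinant cancels and `-I` remains for every `F`, not only on
the constraint set. Hence the `+ p I` in the formula. -/
theorem eshelby_incompressibility (i : Fin 1) (j : Jet n n) :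
    eshelby (incompressibility i) j = -(1 : Matrix (Fin n) (Fin n) ℝ) := by
  rw [eshelby, piola_incompressibility, cof, ← Matrix.transpose_mul, Matrix.adjugate_mul,
    incompressibility, Matrix.transpose_smul, Matrix.transpose_one, ← sub_smul]
  simp

theorem incompressibleWork_eq (W : Jet n n → ℝ) (Ω : Set (Vec n)) (y : Vec n → Vec n)
    (p : Vec n → ℝ) :
    incompressibleWork W Ω y p = boundaryWork W incompressibility Ω y fun _ => p := by
  funext x
  simp [incompressibleWork, boundaryWork, piola_incompressibility, eshelby_incompressibility]

end EnergyFormula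

theorem mainTheorem10 {n : ℕ} (hn : 0 < n) (Ω : Set (Vec n)) (hΩ : IsLipschitzDomain Ω) :
    (∀ (m k : ℕ) (U : Set (Jet n m)) (W : Jet n m → ℝ) (C : Fin k → Jet n m → ℝ)
        (y : Vec n → Vec m) (Λ : Fin k → Vec n → ℝ),
      IsOpen U → ContDiffOn ℝ 1 W U → (∀ i, ContDiffOn ℝ 1 (C i) U) →
      IsScaleFree U W → (∀ i, IsScaleFree U (C i)) →
      IsConstrainedMinimizer U W C Ω y → IsLagrangeMultiplier W C Ω y Λ →
      IntegrableOn (fun x => W (jet Ω y x)) Ω ∧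
      Integrable (boundaryWork W C Ω y Λ) (surfaceMeasure Ω) ∧
      ∫ x in Ω, (n : ℝ) * W (jet Ω y x) = ∫ x, boundaryWork W C Ω y Λ x ∂(surfaceMeasure Ω)) ∧
    (∀ (U : Set (Jet n n)) (W : Jet n n → ℝ) (y : Vec n → Vec n) (p : Vec n → ℝ),
      IsOpen U → ContDiffOn ℝ 1 W U → IsScaleFree U W →
      IsConstrainedMinimizer U W incompressibility Ω y →
      IsLagrangeMultiplier W incompressibility Ω y (fun _ => p) →
      Integrable (incompressibleWork W Ω y p) (surfaceMeasure Ω) ∧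
      ∫ x in Ω, W (jet Ω y x) =
        (1 / (n : ℝ)) * ∫ x, incompressibleWork W Ω y p x ∂(surfaceMeasure Ω)) := by

  refine ⟨fun m k U W C y Λ hU hW hC hWs hCs hy hΛ =>
    integral_eq_integral_boundaryWork hΩ hU hW hC hWs hCs hy.1 hΛ,
    fun U W y p hU hW hWs hy hΛ => ?_⟩
  obtain ⟨_, h1, h2⟩ := integral_eq_integral_boundaryWork hΩ hU hW
    (fun i => (contDiff_incompressibility i).contDiffOn) hWs
    -- The constraint depends on `F` alone, so its scale-freeness is definitional.
    (fun i c _ x y F _ _ => rfl) hy.1 hΛ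
  rw [← incompressibleWork_eq] at h1 h2
  refine ⟨h1, ?_⟩
  rw [← h2, integral_const_mul]
  field_simp
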